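/- Let $m\ge 1$. Let $P$ be a compact oriented surface with boundary (with any number of boundary components, possibly disconnected), $M\subset\partial P$ a finite set of marked points, and $T$ a collection of arcs in the interior of $P$ with endpoints in $M$ such that $(P,M,T)$ is an $(m+2)$-angulation: the arcs cut $P$ into finitely many $(m+2)$-gons, whose vertices are the points of $M$ and whose sides are arcs of $T$ or pieces of $\partial P$. Suppose that every connected component of $P$ contains an arc of $T$ (for connected $P$: $T\neq\emptyset$). Let $M_T\subseteq M$ be the set of marked points incident to an arc of $T$, and let $\mathfrak B$ be the set of pieces into which $M_T$ cuts $\partial P$; for $\mathfrak b\in\mathfrak B$ put $w(\mathfrak b)=\#\big((M\cap\mathfrak b)\setminus M_T\big)$. For the $i$-th boundary component of $P$, let $M_T^i$ be the set of points of $M_T$ and $\mathfrak B_i$ the set of elements of $\mathfrak B$ lying on it. Suppose that $(P,M,T)$ is non-degenerate: every $(m+2)$-gon contains at most one element of $\mathfrak B$. Let $(Q_T,I_T)$ be the following bound quiver. Its vertices are the arcs of $T$; it has one arrow $x\to y$ for each angle of an $(m+2)$-gon between two consecutive sides $\tau_x,\tau_y\in T$ such that $\tau_y$ follows $\tau_x$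 counter-clockwise around the $(m+2)$-gon; and $I_T$ is generated by the paths $\alpha\beta$ in which $\alpha,\beta$ are neighbouring angles of one $(m+2)$-gon. Let $\Lambda=kQ_T/I_T$. The AG-invariant of a gentle bound quiver $(Q,I)$ is the following function $\mathbb N^2\to\mathbb N$. Permitted threads are the maximal paths of positive length not in $I$, together with the trivial paths $e_x$ at vertices $x$ where at most one arrow starts, at most one arrow stops, and $\beta\gamma\notin I$ whenever $\beta$ stops and $\gamma$ starts at $x$. Forbidden threads are the maximal sequences of pairwise different arrows whose consecutive members have product in $I$, together with the trivial paths $e_x$ defined in the same way with $\beta\gamma\in I$. Choose $\sigma,\varepsilon:Q_1\to\{\pm1\}$ such that $\sigma(\alpha)=-\sigma(\beta)$ if $\alpha\ne\beta$ have the same source, $\varepsilon(\alpha)=-\varepsilon(\beta)$ if $\alpha\neq\beta$ have the same target, and, for $t(\alpha)=s(\beta)$, $\sigma(\beta)=-\varepsilon(\alpha)$ if $\alpha\beta\notin I$ and $\sigma(\beta)=\varepsilon(\alpha)$ if $\alpha\beta\in I$. A non-trivial thread takes $\sigma$ from its first and $\varepsilon$ from its last arrow. For a trivial permitted thread $h_x$,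 $\sigma(h_x)=-\varepsilon(h_x)$, with $\sigma(h_x)=-\sigma(\alpha)$ if $\alpha$ starts at $x$ and $\varepsilon(h_x)=-\varepsilon(\beta)$ if $\beta$ stops at $x$; for a trivial forbidden thread $p_x$, $\sigma(p_x)=\varepsilon(p_x)$, with $\sigma(p_x)=-\sigma(\alpha)$ if $\alpha$ starts at $x$ and $\varepsilon(p_x)=-\varepsilon(\beta)$ if $\beta$ stops at $x$. (If no arrow touches $x$, each of $h_x,p_x$ is counted twice, once with each sign.) Starting from a permitted thread $H_0$, let $F_i$ be the forbidden thread that ends where $H_i$ ends and has $\varepsilon(F_i)=-\varepsilon(H_i)$, and let $H_{i+1}$ be the permitted thread that starts where $F_i$ starts and has $\sigma(H_{i+1})=-\sigma(F_i)$; stop at the first $n\ge1$ with $H_n=H_0$, and record the pair consisting of $n$ and the total number of arrows of $F_0,\dots,F_{n-1}$. Repeat until all permitted threads have occurred. Finally record $(0,n)$ for each oriented cycle of $n$ pairwise different arrows in which each pair of consecutive arrows has product in $I$. The AG-invariant sends $(x,y)$ to the number of times that $(x,y)$ is recorded. Then $(Q_T,I_T)$ is gentle (with $\Lambda$ finite-dimensional),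 sign functions $\sigma,\varepsilon$ as above exist, and for every choice of them the AG-invariant of $\Lambda$ is $$t\,(0,m+2)^*+\sum_i (a_i,b_i)^*,$$ where $(a,b)^*$ is the function that is $1$ at $(a,b)$ and $0$ elsewhere, $t$ is the number of internal $(m+2)$-gons (those all of whose sides are arcs of $T$), $i$ runs over the boundary components of $P$, and $$a_i=\#M_T^i,\qquad b_i=\sum_{\mathfrak b\in\mathfrak B_i}\big(m-w(\mathfrak b)\big).$$ -/

import Mathlib

universe u v

/-! ### Bound quivers with quadratic monomial relations and the AG-invariant -/

/-- A quiver `Q` (vertices `V`, arrows `A`, source and target maps) together with a set of paths of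
length two generating an ideal `I`: `rel α β` says that the path `αβ` (first `α`, then `β`) is one
of the generators. -/
structure BoundQuiver where
  V : Type u
  A : Type v
  src : A → V
  tgt : A → V
  rel : A → A → Prop
  tgt_eq_src_of_rel : ∀ α β, rel α β → tgt α = src β

namespace BoundQuiver

variable (Q : BoundQuiver.{u, v})

/-- A path of positive length, as the list of its arrows `α₁ α₂ ⋯ αₙ`. -/
def IsPath (l : List Q.A) : Prop :=
  l ≠ [] ∧ l.IsChain (fun α β => Q.tgt α = Q.src β)

/-- A path lies in the monomial ideal `I` iff one of the generators of `I` is a subpath of it. -/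
def InIdeal (l : List Q.A) : Prop :=
  ∃ α β, Q.rel α β ∧ [α, β] <:+: l

/-- A permitted path: a path that is not in `I`. -/
def IsPermitted (l : List Q.A) : Prop :=
  Q.IsPath l ∧ ¬ Q.InIdeal l

/-- A forbidden path: pairwise different arrows, consecutive ones having their product in `I`. -/
def IsForbidden (l : List Q.A) : Prop :=
  l ≠ [] ∧ l.Nodup ∧ l.IsChain Q.rel

/-- `(Q, I)` is gentle: the conditions (G1), (G3), (G4) on a finite quiver ((G2) is built into
`BoundQuiver`), and `kQ/I` is finite-dimensional. The vertices of `Q` and the permitted paths give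
a basis of `kQ/I`, so the latter says that there are finitely many permitted paths. -/
structure IsGentle : Prop where
  finite_vertices : Finite Q.V
  finite_arrows : Finite Q.A
  starts_le_two : ∀ x, {α | Q.src α = x}.ncard ≤ 2
  stops_le_two : ∀ x, {α | Q.tgt α = x}.ncard ≤ 2
  rel_left_unique : ∀ α α' β, Q.rel α β → Q.rel α' β → α = α'
  rel_right_unique : ∀ β γ γ', Q.rel β γ → Q.rel β γ' → γ = γ'
  nonrel_left_unique : ∀ α α' β, Q.tgt α = Q.src β → ¬ Q.rel α β →
    Q.tgt α' = Q.src β → ¬ Q.rel α' β → α = α'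
  nonrel_right_unique : ∀ β γ γ', Q.tgt β = Q.src γ → ¬ Q.rel β γ →
    Q.tgt β = Q.src γ' → ¬ Q.rel β γ' → γ = γ'
  finite_permitted : {l | Q.IsPermitted l}.Finite

/-- Non-trivial permitted threads: the maximal permitted paths. -/
def IsPermittedThread (l : List Q.A) : Prop :=
  Q.IsPermitted l ∧ ∀ β, ¬ Q.IsPermitted (β :: l) ∧ ¬ Q.IsPermitted (l ++ [β])

/-- Non-trivial forbidden threads: the maximal forbidden paths. -/
def IsForbiddenThread (l : List Q.A) : Prop :=
  Q.IsForbidden l ∧ ∀ β, ¬ Q.IsForbidden (β :: l) ∧ ¬ Q.IsForbidden (l ++ [β])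

/-- At most one arrow starts at `x` and at most one arrow ends at `x`. -/
def IsThin (x : Q.V) : Prop :=
  (∀ α β, Q.src α = x → Q.src β = x → α = β) ∧ (∀ α β, Q.tgt α = x → Q.tgt β = x → α = β)

/-- `e_x` is a trivial permitted thread. -/
def IsTrivialPermitted (x : Q.V) : Prop :=
  Q.IsThin x ∧ ∀ β γ, Q.tgt β = x → Q.src γ = x → ¬ Q.rel β γ

/-- `e_x` is a trivial forbidden thread. -/
def IsTrivialForbidden (x : Q.V) : Prop :=
  Q.IsThin x ∧ ∀ β γ, Q.tgt β = x → Q.src γ = x → Q.rel β γ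

/-- A choice of the sign functions `σ, ε : Q₁ → {-1, 1}`. In a gentle bound quiver the last field
follows from the first three, except when `α` and `β` are the only arrows that stop and start at
the vertex between them; there it says exactly that the sign `σ(p_y) = ε(p_y)` of the trivial
forbidden thread at that vertex (equal to `-σ(β)` and to `-ε(α)`, see `FThread`) is well defined. -/
structure Signs where
  σ : Q.A → ℤˣ
  ε : Q.A → ℤˣ
  src_eq : ∀ α β, α ≠ β → Q.src α = Q.src β → σ α = -σ β
  tgt_eq : ∀ α β, α ≠ β → Q.tgt α = Q.tgt β → ε α = -ε β
  of_not_rel : ∀ α β, Q.tgt α = Q.src β → ¬ Q.rel α β → σ β = -ε α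
  of_rel : ∀ α β, Q.rel α β → σ β = ε α

namespace Signs

variable {Q} (S : Q.Signs)

/-- Permitted threads with their signs: the non-trivial ones, and the trivial ones `h_x` recorded
as pairs `(x, σ(h_x))`, where `σ(h_x) = -ε(h_x)`, `σ(h_x) = -σ(α)` if `α` starts at `x`, and
`ε(h_x) = -ε(β)` if `β` stops at `x`. If no arrow touches `x`, the sign is not determined, and `h_x`
is counted once with each sign. -/
def PThread : Type (max u v) :=
  {l : List Q.A // Q.IsPermittedThread l} ⊕
  {h : Q.V × ℤˣ // Q.IsTrivialPermitted h.1 ∧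
    (∀ α, Q.src α = h.1 → h.2 = -S.σ α) ∧ (∀ β, Q.tgt β = h.1 → -h.2 = -S.ε β)}

/-- Forbidden threads with their signs: the non-trivial ones, and the trivial ones `p_y` recorded
as pairs `(y, σ(p_y))`, where `σ(p_y) = ε(p_y)`, `σ(p_y) = -σ(γ)` if `γ` starts at `y`, and
`ε(p_y) = -ε(δ)` if `δ` stops at `y`. If no arrow touches `y`, then `p_y` is counted once with each
sign. -/
def FThread : Type (max u v) :=
  {l : List Q.A // Q.IsForbiddenThread l} ⊕
  {p : Q.V × ℤˣ // Q.IsTrivialForbidden p.1 ∧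
    (∀ γ, Q.src γ = p.1 → p.2 = -S.σ γ) ∧ (∀ δ, Q.tgt δ = p.1 → p.2 = -S.ε δ)}

namespace PThread

variable {S}

/-- The vertex where a permitted thread starts. -/
def start : S.PThread → Q.V
  | .inl l => Q.src (l.1.head l.2.1.1.1)
  | .inr h => h.1.1

/-- The vertex where a permitted thread ends. -/
def finish : S.PThread → Q.V
  | .inl l => Q.tgt (l.1.getLast l.2.1.1.1)
  | .inr h => h.1.1

/-- `σ` of a permitted thread. -/
def sgnσ : S.PThread → ℤˣ
  | .inl l => S.σ (l.1.head l.2.1.1.1)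
  | .inr h => h.1.2

/-- `ε` of a permitted thread. -/
def sgnε : S.PThread → ℤˣ
  | .inl l => S.ε (l.1.getLast l.2.1.1.1)
  | .inr h => -h.1.2

end PThread

namespace FThread

variable {S}

/-- The vertex where a forbidden thread starts. -/
def start : S.FThread → Q.V
  | .inl l => Q.src (l.1.head l.2.1.1)
  | .inr p => p.1.1

/-- The vertex where a forbidden thread ends. -/
def finish : S.FThread → Q.V
  | .inl l => Q.tgt (l.1.getLast l.2.1.1)
  | .inr p => p.1.1

/-- `σ` of a forbidden thread. -/
def sgnσ : S.FThread → ℤˣ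
  | .inl l => S.σ (l.1.head l.2.1.1)
  | .inr p => p.1.2

/-- `ε` of a forbidden thread. -/
def sgnε : S.FThread → ℤˣ
  | .inl l => S.ε (l.1.getLast l.2.1.1)
  | .inr p => p.1.2

/-- The number of arrows of a forbidden thread. -/
def length : S.FThread → ℕ
  | .inl l => l.1.length
  | .inr _ => 0

end FThread

/-- `H₀, F₀, H₁, F₁, …` is a run of the algorithm which stops after `n ≥ 1` rounds: `F i` is a
forbidden thread ending where `H i` ends, with opposite `ε`; `H (i + 1)` is a permitted thread
starting where `F i` starts, with opposite `σ`; and `n` is the first positive index at which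
`H₀` comes back. -/
def IsRun (n : ℕ) (H : ℕ → S.PThread) (F : ℕ → S.FThread) : Prop :=
  0 < n ∧
  (∀ i, (F i).finish = (H i).finish ∧ (H i).sgnε = -(F i).sgnε) ∧
  (∀ i, (H (i + 1)).start = (F i).start ∧ (F i).sgnσ = -(H (i + 1)).sgnσ) ∧
  H n = H 0 ∧ ∀ i, 0 < i → i < n → H i ≠ H 0

/-- The AG-invariant, as a function of the ordered pair `(x, y)`. The first summand counts the runs
of the algorithm (one for each set of permitted threads met by a run) which have `x` rounds and
forbidden threads of total length `y`. The second summand, present for `x = 0`, counts the oriented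
cycles with `y` arrows in which each pair of consecutive arrows is a relation. -/
noncomputable def agInvariant (x y : ℕ) : ℕ :=
  {O : Set S.PThread | ∃ H F, S.IsRun x H F ∧ O = H '' {i | i < x} ∧
    ∑ i ∈ Finset.range x, (F i).length = y}.ncard +
  (if x = 0 then
    {c : Cycle Q.A | c ≠ Cycle.nil ∧ c.Nodup ∧ c.Chain Q.rel ∧ c.length = y}.ncard
  else 0)

end Signs

end BoundQuiver

/-! ### Surfaces with boundary subdivided into polygons -/

/-- The model of a polygon: the closed unit disc, whose boundary circle is cut into sides. -/
abbrev PolygonModel : Type := Metric.closedBall (0 : ℂ) 1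

/-- The point with parameter `u ∈ [0, 1]` on the `j`-th side of the `N`-gon. The `j`-th side runs
counter-clockwise from the vertex `exp (2πij/N)` to the vertex `exp (2πi(j+1)/N)`. -/
noncomputable def sidePoint {N : ℕ} (j : Fin N) (u : unitInterval) : PolygonModel :=
  ⟨Complex.exp (((2 * Real.pi * ((j : ℝ) + (u : ℝ)) / (N : ℝ) : ℝ) : ℂ) * Complex.I), by
    rw [mem_closedBall_zero_iff, Complex.norm_exp_ofReal_mul_I]⟩

/-- The identifications of boundary points of polygons (indexed by `F`) prescribed by a pairing
`mate` of their sides: two different paired sides are glued to each other with opposite directions,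
so that the orientations of the polygons fit together; a side paired with itself is left alone. -/
inductive GlueRel {F : Type v} {N : ℕ} (mate : F × Fin N → F × Fin N) :
    F × PolygonModel → F × PolygonModel → Prop
  | glue (s : F × Fin N) (hs : mate s ≠ s) (u : unitInterval) :
      GlueRel mate (s.1, sidePoint s.2 u)
        ((mate s).1, sidePoint (mate s).2 (unitInterval.symm u))

/-- A subdivision of an oriented surface with boundary `P` into `(m+2)`-gons, indexed by `F`. The
`f`-th polygon is parametrised, respecting orientations, by `χ f`, and `P` is what one gets from
these polygons by gluing some of their sides in pairs. -/
structure PolygonSubdivision (m : ℕ) (P : Type u) [TopologicalSpace P] (F : Type v) where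
  mate : F × Fin (m + 2) → F × Fin (m + 2)
  mate_mate : ∀ s, mate (mate s) = s
  χ : F → PolygonModel → P
  continuous_χ : ∀ f, Continuous (χ f)
  exists_χ_eq : ∀ p, ∃ f z, χ f z = p
  χ_eq_χ_iff : ∀ f z f' z', χ f z = χ f' z' ↔ Relation.EqvGen (GlueRel mate) (f, z) (f', z')

namespace PolygonSubdivision

variable {m : ℕ} {P : Type u} [TopologicalSpace P] {F : Type v} (D : PolygonSubdivision m P F)

/-- The `(m+2)`-gon with index `f`, as a subset of `P`. -/
def polygon (f : F) : Set P := Set.range (D.χ f)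

/-- A side of a polygon, as a subset of `P`. -/
def side (s : F × Fin (m + 2)) : Set P := Set.range fun u => D.χ s.1 (sidePoint s.2 u)

/-- The side following `s` counter-clockwise around its polygon. -/
def next (s : F × Fin (m + 2)) : F × Fin (m + 2) := (s.1, s.2 + 1)

/-- The set `M` of marked points: the vertices of the polygons. -/
def marked : Set P := {p | ∃ s : F × Fin (m + 2), p = D.χ s.1 (sidePoint s.2 0)}

/-- The set `T` of arcs: the curves in `P` along which two sides of polygons are glued. -/
def arcs : Set (Set P) := {τ | ∃ s, D.mate s ≠ s ∧ τ = D.side s}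

/-- The boundary of `P`: the union of the sides that are not glued. -/
def boundary : Set P := {p | ∃ s, D.mate s = s ∧ p ∈ D.side s}

/-- The boundary components of `P`. -/
def boundaryComponents : Set (Set P) :=
  {C | ∃ p ∈ D.boundary, C = connectedComponentIn D.boundary p}

/-- The set `M_T` of marked points that are incident to an arc. -/
def markedT : Set P := {p | p ∈ D.marked ∧ ∃ τ ∈ D.arcs, p ∈ τ}

/-- The set `𝔅` of boundary segments: the pieces into which `M_T` cuts the boundary of `P`, recorded
without their endpoints. -/
def segments : Set (Set P) :=
  {b | ∃ p ∈ D.boundary \ D.markedT, b = connectedComponentIn (D.boundary \ D.markedT) p}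

/-- The weight of a boundary segment: the number of marked points on it that are not in `M_T`. -/
noncomputable def weight (b : Set P) : ℕ := ((D.marked ∩ b) \ D.markedT).ncard

/-- The internal polygons: those all of whose sides are arcs. -/
def internal : Set F := {f | ∀ j, D.side (f, j) ∈ D.arcs}

/-- The bound quiver `(Q_T, I_T)`. Its vertices are the arcs in `T`. Its arrows are the angles formed
by two consecutive sides `s`, `next s` of a polygon that both are arcs; such an arrow goes from the
arc `s` to the arc `next s`, which follows `s` counter-clockwise around the polygon. The generators
of `I_T` are the paths formed by two neighbouring angles of one polygon. -/
def boundQuiver : BoundQuiver.{u, v} where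
  V := {τ : Set P // τ ∈ D.arcs}
  A := {s : F × Fin (m + 2) // D.side s ∈ D.arcs ∧ D.side (next s) ∈ D.arcs}
  src α := ⟨D.side α.1, α.2.1⟩
  tgt α := ⟨D.side (next α.1), α.2.2⟩
  rel α β := β.1 = next α.1
  tgt_eq_src_of_rel α β h := by
    apply Subtype.ext
    change D.side (next α.1) = D.side β.1
    rw [h]

end PolygonSubdivision

/-- An `(m+2)`-angulation `(P, M, T)` of an oriented surface with boundary: a subdivision into
`(m+2)`-gons all of whose vertices lie on the boundary of the surface (there are no punctures). -/
structure Angulation (m : ℕ) (P : Type u) [TopologicalSpace P] (F : Type v) extends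
    PolygonSubdivision m P F where
  marked_subset_boundary : toPolygonSubdivision.marked ⊆ toPolygonSubdivision.boundary

/-- Non-degenerate: every `(m+2)`-gon contains at most one boundary segment from `𝔅`. -/
def Angulation.Nondegenerate {m : ℕ} {P : Type u} [TopologicalSpace P] {F : Type v}
    (D : Angulation m P F) : Prop :=
  ∀ f, ∀ b ∈ D.segments, ∀ b' ∈ D.segments, b ⊆ D.polygon f → b' ⊆ D.polygon f → b = b'

/-- The function `(a, b)^*`, equal to `1` at `(a, b)` and to `0` at all other pairs. -/
def pairStar (a b : ℤ) (x y : ℕ) : ℕ := if (x : ℤ) = a ∧ (y : ℤ) = b then 1 else 0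

/-! Everything is read off from one permutation `rot` of the sides of the polygons. On a glued side
it turns around the initial vertex to the next side issuing from that vertex; on a boundary side it
moves on along the boundary. Without punctures every orbit contains boundary sides, and the orbits
are the boundary components. In an orbit, blocks of glued sides (the arcs at one point of M_T)
alternate with blocks of boundary sides (one segment of 𝔅, which lies in a single polygon). Hence
the set `starts` of the first elements of the blocks of glued sides is in bijection with M_T via
`corner` and with 𝔅 via `seg`.

In the quiver, an arrow is continued either by the next angle of its polygon (a relation) or by the
next angle around a vertex (no relation). So permitted threads are the fans of arcs at the points of
M_T, one for each start, and forbidden threads are blocks of consecutive arcs of a polygon. Sign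
functions amount to a sign on every glued side, opposite on mates (`exists_isOrientationOf`); thus
an arc with a sign is one of its two sides. This makes the algorithm deterministic and treats
trivial threads as blocks with a single arc.

The fan of a start `c` ends at an arc whose other side `t` is followed by a boundary side. By
nondegeneracy the boundary sides of this polygon form one block, and walking along it leads to the
first arc `d` of the same polygon. The forbidden thread is the block from `d` to `t`, and the next
permitted thread is the fan of `d`. So a round of the algorithm is the first return of `rot` to
`starts` (`IsFan.firstReturn`). A run exhausts one boundary component, its rounds count the points
of M_T there, and each round contributes the number of angles between arcs in one polygon, which is
m - w by counting sides (`weight_add_numAngles`). Cycles with full relations go once around an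
internal polygon (`ncard_cycles`). -/

/-! ### Points on the sides of the model polygon -/

theorem sidePoint_one {m : ℕ} (j : Fin (m + 2)) : sidePoint j 1 = sidePoint (j + 1) 0 := by
  apply Subtype.ext
  simp only [sidePoint, Set.Icc.coe_one, Set.Icc.coe_zero, add_zero]
  -- On the last side `j + 1` wraps around to `0`, and the two angles differ by a full turn.
  rcases eq_or_ne j (Fin.last _) with rfl | h
  · have h1 : (2 * Real.pi * (((Fin.last (m + 1) : Fin (m + 2)) : ℝ) + 1) / ((m + 2 : ℕ) : ℝ) : ℝ)
        = 2 * Real.pi := by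
      have : (((Fin.last (m + 1) : Fin (m + 2)) : ℕ) : ℝ) = m + 1 := by simp
      rw [this]
      push_cast
      field_simp
      ring
    rw [h1]
    simp [Complex.exp_two_pi_mul_I]
  · rw [Fin.val_add_one_of_lt (Fin.lt_last_iff_ne_last.2 h)]
    push_cast
    rfl

/-- The parameter `1` is excluded because it gives the start of the next side. On half-open sides
both angles lie in one period, so the number `k` of full turns between them is zero. -/
theorem sidePoint_eq_iff {N : ℕ} [NeZero N] {j j' : Fin N} {u u' : unitInterval}
    (hu : (u : ℝ) < 1) (hu' : (u' : ℝ) < 1) :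
    sidePoint j u = sidePoint j' u' ↔ j = j' ∧ u = u' := by
  refine ⟨fun h => ?_, by rintro ⟨rfl, rfl⟩; rfl⟩
  have h := congrArg Subtype.val h
  simp only [sidePoint] at h
  obtain ⟨k, hk⟩ := Complex.exp_eq_exp_iff_exists_int.1 h
  have hN : (0 : ℝ) < N := Nat.cast_pos.2 (Nat.pos_of_ne_zero (NeZero.ne N))
  have hk' : 2 * Real.pi * ((j : ℝ) + u) / N = 2 * Real.pi * ((j' : ℝ) + u') / N
      + k * (2 * Real.pi) := by
    have h2 : (((2 * Real.pi * ((j : ℝ) + u) / N : ℝ) : ℂ)) * Complex.I =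
        ((2 * Real.pi * ((j' : ℝ) + u') / N + k * (2 * Real.pi) : ℝ) : ℂ) * Complex.I := by
      rw [hk]; push_cast; ring
    exact_mod_cast mul_right_cancel₀ Complex.I_ne_zero h2
  have h3 : (j : ℝ) + u = j' + u' + k * N := by
    have hpi := Real.pi_pos
    field_simp at hk'
    nlinarith
  have b1 : ((j : ℕ) : ℝ) + 1 ≤ N := by exact_mod_cast j.2
  have b2 : ((j' : ℕ) : ℝ) + 1 ≤ N := by exact_mod_cast j'.2
  have n1 : (0 : ℝ) ≤ ((j : ℕ) : ℝ) := Nat.cast_nonneg _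
  have n2 : (0 : ℝ) ≤ ((j' : ℕ) : ℝ) := Nat.cast_nonneg _
  have u1 := u.2.1
  have u2 := u'.2.1
  have k1 : (k : ℝ) < 1 := by
    by_contra hc
    push Not at hc
    nlinarith
  have k2 : (-1 : ℝ) < k := by
    by_contra hc
    push Not at hc
    nlinarith
  have k0 : k = 0 := by
    have : k < 1 := by exact_mod_cast k1
    have : -1 < k := by exact_mod_cast k2
    omega
  subst k0
  simp only [Int.cast_zero, zero_mul, add_zero] at h3
  have hj : (j : ℕ) = j' := by
    have a1 : ((j : ℕ) : ℝ) < (j' : ℕ) + 1 := by linarith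
    have a2 : ((j' : ℕ) : ℝ) < (j : ℕ) + 1 := by linarith
    have a1 : (j : ℕ) < (j' : ℕ) + 1 := by exact_mod_cast a1
    have a2 : (j' : ℕ) < (j : ℕ) + 1 := by exact_mod_cast a2
    omega
  refine ⟨Fin.ext hj, Subtype.ext ?_⟩
  rw [hj] at h3
  linarith

/-- A property of points of the polygons that is stable under each single gluing is constant on the
fibres of χ. The fibres are computed below by choosing such properties. -/
theorem Relation.EqvGen.iff_of_forall {α : Type*} {r : α → α → Prop} {p : α → Prop}
    (h : ∀ x y, r x y → (p x ↔ p y)) {x y : α} (hxy : Relation.EqvGen r x y) : p x ↔ p y := by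
  induction hxy with
  | rel x y hr => exact h x y hr
  | refl x => exact Iff.rfl
  | symm x y _ ih => exact ih.symm
  | trans x y z _ _ ih1 ih2 => exact ih1.trans ih2

/-! ### The rotation of the sides and the fibres of the gluing map -/

namespace PolygonSubdivision

variable {m : ℕ} {P : Type u} [TopologicalSpace P] {F : Type v} (D : PolygonSubdivision m P F)

/-- The side preceding `s` counter-clockwise around its polygon. -/
def prev (s : F × Fin (m + 2)) : F × Fin (m + 2) := (s.1, s.2 - 1)

@[simp] theorem next_prev (s : F × Fin (m + 2)) : next (prev s) = s := by
  simp [next, prev]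

@[simp] theorem prev_next (s : F × Fin (m + 2)) : prev (next s) = s := by
  simp [next, prev]

theorem next_injective : Function.Injective (next : F × Fin (m + 2) → F × Fin (m + 2)) :=
  Function.LeftInverse.injective prev_next

@[simp] theorem next_fst (s : F × Fin (m + 2)) : (next s).1 = s.1 := rfl

theorem next_iterate_fst (s : F × Fin (m + 2)) (k : ℕ) : (next^[k] s).1 = s.1 := by
  induction k with
  | zero => rfl
  | succ k ih => rw [Function.iterate_succ_apply', next_fst, ih]

theorem next_iterate_snd (s : F × Fin (m + 2)) (k : ℕ) :
    ((next^[k] s).2 : ℕ) = (s.2 + k) % (m + 2) := by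
  induction k with
  | zero => simp [Nat.mod_eq_of_lt]
  | succ k ih =>
    rw [Function.iterate_succ_apply']
    change (((next^[k] s).2 + 1 : Fin (m + 2)) : ℕ) = _
    rw [Fin.val_add, ih, Fin.val_one, Nat.mod_add_mod, add_assoc]

theorem next_iterate_period (s : F × Fin (m + 2)) : next^[m + 2] s = s := by
  refine Prod.ext (next_iterate_fst _ _) (Fin.ext ?_)
  rw [next_iterate_snd]
  simp [Nat.mod_eq_of_lt]

theorem exists_next_iterate_eq {s t : F × Fin (m + 2)} (h : s.1 = t.1) :
    ∃ k < m + 2, next^[k] s = t := by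
  refine ⟨(t.2 - s.2 : Fin (m + 2)), Fin.is_lt _, Prod.ext ?_ (Fin.ext ?_)⟩
  · rw [next_iterate_fst, h]
  · rw [next_iterate_snd, ← Fin.val_add, add_sub_cancel]

/-- The sides of the polygons that are glued to another side. -/
def IsArc (s : F × Fin (m + 2)) : Prop := D.mate s ≠ s

/-- The permutation of the sides that rotates around the initial vertex of a glued side, and that
runs along the boundary on the other sides. -/
def rot : Equiv.Perm (F × Fin (m + 2)) where
  toFun s := next (D.mate s)
  invFun s := D.mate (prev s)
  left_inv s := by simp [D.mate_mate]
  right_inv s := by simp [D.mate_mate]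

/-- The initial vertex of a side. -/
noncomputable def corner (s : F × Fin (m + 2)) : P := D.χ s.1 (sidePoint s.2 0)

theorem rot_apply (s : F × Fin (m + 2)) : D.rot s = next (D.mate s) := rfl

theorem rot_symm_apply (s : F × Fin (m + 2)) : D.rot.symm s = D.mate (prev s) := rfl

variable {D}

theorem isArc_mate {s : F × Fin (m + 2)} : D.IsArc (D.mate s) ↔ D.IsArc s := by
  simp [IsArc, D.mate_mate, eq_comm]

theorem rot_of_not_isArc {s : F × Fin (m + 2)} (h : ¬ D.IsArc s) : D.rot s = next s := by
  rw [rot_apply, not_not.1 h]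

theorem isArc_rot_symm {s : F × Fin (m + 2)} : D.IsArc (D.rot.symm s) ↔ D.IsArc (prev s) := by
  rw [rot_symm_apply, isArc_mate]

variable (D)

theorem χ_glue (s : F × Fin (m + 2)) (u : unitInterval) :
    D.χ s.1 (sidePoint s.2 u) =
      D.χ (D.mate s).1 (sidePoint (D.mate s).2 (unitInterval.symm u)) ∨ ¬ D.IsArc s := by
  by_cases h : D.IsArc s
  · exact Or.inl ((D.χ_eq_χ_iff _ _ _ _).2 (.rel _ _ (.glue s h u)))
  · exact Or.inr h

theorem χ_one (s : F × Fin (m + 2)) : D.χ s.1 (sidePoint s.2 1) = D.corner (next s) := by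
  rw [sidePoint_one]; rfl

theorem corner_mem_side (s : F × Fin (m + 2)) : D.corner s ∈ D.side s := ⟨0, rfl⟩

theorem corner_next_mem_side (s : F × Fin (m + 2)) : D.corner (next s) ∈ D.side s :=
  ⟨1, D.χ_one s⟩

variable {D}

/-- Gluing reverses directions: the initial vertex of `s` is the terminal vertex of its mate, where
the next side begins. -/
theorem corner_rot {s : F × Fin (m + 2)} (h : D.IsArc s) : D.corner (D.rot s) = D.corner s := by
  have := (D.χ_glue s 0).resolve_right (not_not.2 h)
  rw [unitInterval.symm_zero, χ_one] at this
  exact this.symm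

variable (D)

theorem side_mate (s : F × Fin (m + 2)) : D.side (D.mate s) = D.side s := by
  by_cases h : D.IsArc s
  · apply Set.Subset.antisymm
    · rintro _ ⟨u, rfl⟩
      refine ⟨unitInterval.symm u, ?_⟩
      have := (D.χ_glue s (unitInterval.symm u)).resolve_right (not_not.2 h)
      simpa using this
    · rintro _ ⟨u, rfl⟩
      exact ⟨unitInterval.symm u, ((D.χ_glue s u).resolve_right (not_not.2 h)).symm⟩
  · rw [not_not.1 h]

variable {D}

/-- A point in the relative interior of a side lies only on this side and its mate. -/
theorem eq_or_eq_of_χ_eq {s t : F × Fin (m + 2)} {u v : unitInterval} (h0 : 0 < (u : ℝ))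
    (h1 : (u : ℝ) < 1) (h : D.χ s.1 (sidePoint s.2 u) = D.χ t.1 (sidePoint t.2 v)) :
    (t = s ∧ v = u) ∨ (t = D.mate s ∧ v = unitInterval.symm u) := by
  -- A relatively interior point determines its side and parameter. The parameter `v = 1` is the
  -- start of the next side, which is excluded by `0 < u`.
  have key : ∀ (s t : F × Fin (m + 2)) (u v : unitInterval), 0 < (u : ℝ) → (u : ℝ) < 1 →
      (t.1, sidePoint t.2 v) = (s.1, sidePoint s.2 u) → t = s ∧ v = u := by
    intro s t u v h0 h1 h
    obtain ⟨hf, hj⟩ := Prod.mk.inj h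
    rcases lt_or_eq_of_le v.2.2 with hv | hv
    · obtain ⟨hj', rfl⟩ := (sidePoint_eq_iff hv h1).1 hj
      exact ⟨Prod.ext hf hj', rfl⟩
    · have : v = 1 := Subtype.ext hv
      subst this
      rw [sidePoint_one] at hj
      obtain ⟨-, rfl⟩ := (sidePoint_eq_iff (by simp) h1).1 hj
      simp at h0
  have hs0 : 0 < ((unitInterval.symm u : unitInterval) : ℝ) := by
    rw [unitInterval.coe_symm_eq]; linarith
  have hs1 : ((unitInterval.symm u : unitInterval) : ℝ) < 1 := by
    rw [unitInterval.coe_symm_eq]; linarith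
  have hcl : ∀ (s' : F × Fin (m + 2)) (u' : unitInterval),
      ((s'.1, sidePoint s'.2 u') = (s.1, sidePoint s.2 u) ∨ (s'.1, sidePoint s'.2 u') =
        ((D.mate s).1, sidePoint (D.mate s).2 (unitInterval.symm u))) →
      (((D.mate s').1, sidePoint (D.mate s').2 (unitInterval.symm u')) = (s.1, sidePoint s.2 u) ∨
        ((D.mate s').1, sidePoint (D.mate s').2 (unitInterval.symm u')) =
        ((D.mate s).1, sidePoint (D.mate s).2 (unitInterval.symm u))) := by
    rintro s' u' (h | h)
    · obtain ⟨rfl, rfl⟩ := key _ _ _ _ h0 h1 h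
      exact Or.inr rfl
    · obtain ⟨rfl, rfl⟩ := key _ _ _ _ hs0 hs1 h
      left
      simp [D.mate_mate]
  -- The point and its image on the mate form a set stable under gluing, so they are the whole
  -- fibre.
  have := (Relation.EqvGen.iff_of_forall (p := fun x => x = (s.1, sidePoint s.2 u) ∨
    x = ((D.mate s).1, sidePoint (D.mate s).2 (unitInterval.symm u))) ?_
    ((D.χ_eq_χ_iff _ _ _ _).1 h)).1 (Or.inl rfl)
  · rcases this with h | h
    · exact Or.inl (key _ _ _ _ h0 h1 h)
    · exact Or.inr (key _ _ _ _ hs0 hs1 h)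
  · rintro _ _ ⟨s', hs', u'⟩
    refine ⟨hcl s' u', fun h => ?_⟩
    have := hcl (D.mate s') (unitInterval.symm u') h
    simpa [D.mate_mate] using this

/-- Two corners represent the same marked point iff one gets from one to the other by crossing
arcs. -/
theorem eqvGen_of_corner_eq {s t : F × Fin (m + 2)} (h : D.corner s = D.corner t) :
    Relation.EqvGen (fun a b => D.IsArc a ∧ b = D.rot a) s t := by
  set V := Relation.EqvGen (fun a b => D.IsArc a ∧ b = D.rot a) with hV
  have key : ∀ (s t : F × Fin (m + 2)) (u : unitInterval),
      (s.1, sidePoint s.2 u) = (t.1, sidePoint t.2 0) → (u = 0 ∧ s = t) ∨ (u = 1 ∧ next s = t) := by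
    intro s t u h
    obtain ⟨hf, hj⟩ := Prod.mk.inj h
    rcases lt_or_eq_of_le u.2.2 with hu | hu
    · obtain ⟨hj', rfl⟩ := (sidePoint_eq_iff hu (by simp)).1 hj
      exact Or.inl ⟨rfl, Prod.ext hf hj'⟩
    · have : u = 1 := Subtype.ext hu
      subst this
      rw [sidePoint_one] at hj
      obtain ⟨hj, -⟩ := (sidePoint_eq_iff (by simp) (by simp)).1 hj
      exact Or.inr ⟨rfl, Prod.ext hf hj⟩
  -- Only the end points of a glued side are vertices: gluing at `u' = 0` applies `rot`, gluing at
  -- `u' = 1` undoes it.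
  have hcl : ∀ (s' : F × Fin (m + 2)) (u' : unitInterval), D.IsArc s' →
      (∃ t', V s t' ∧ (s'.1, sidePoint s'.2 u') = (t'.1, sidePoint t'.2 0)) →
      ∃ t', V s t' ∧ ((D.mate s').1, sidePoint (D.mate s').2 (unitInterval.symm u')) =
        (t'.1, sidePoint t'.2 0) := by
    rintro s' u' hs' ⟨t', ht', h⟩
    rcases key _ _ _ h with ⟨rfl, rfl⟩ | ⟨rfl, rfl⟩
    · refine ⟨D.rot s', ht'.trans _ _ _ (.rel _ _ ⟨hs', rfl⟩), ?_⟩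
      rw [unitInterval.symm_zero, sidePoint_one]
      rfl
    · refine ⟨D.mate s', ht'.trans _ _ _ (.symm _ _ (.rel _ _ ⟨isArc_mate.2 hs', ?_⟩)), ?_⟩
      · rw [rot_apply, D.mate_mate]
      · rw [unitInterval.symm_one]
  have := (Relation.EqvGen.iff_of_forall (p := fun x => ∃ t', V s t' ∧
    x = (t'.1, sidePoint t'.2 0)) ?_ ((D.χ_eq_χ_iff _ _ _ _).1 h)).1 ⟨s, .refl _, rfl⟩
  · obtain ⟨t', ht', h⟩ := this
    rcases key _ _ _ h with ⟨-, rfl⟩ | ⟨h, -⟩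
    · exact ht'
    · simp at h
  · rintro _ _ ⟨s', hs', u'⟩
    refine ⟨hcl s' u' hs', fun h => ?_⟩
    have := hcl (D.mate s') (unitInterval.symm u') (isArc_mate.2 hs') h
    simpa [D.mate_mate] using this

theorem sameCycle_of_corner_eq {s t : F × Fin (m + 2)} (h : D.corner s = D.corner t) :
    D.rot.SameCycle s t := by
  have h' := eqvGen_of_corner_eq h
  clear h
  induction h' with
  | rel x y hr => rw [hr.2]; exact Equiv.Perm.sameCycle_apply_right.2 (Equiv.Perm.SameCycle.refl _ _)
  | refl x => exact Equiv.Perm.SameCycle.refl _ _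
  | symm x y _ ih => exact ih.symm
  | trans x y z _ _ ih1 ih2 => exact ih1.trans ih2

end PolygonSubdivision

/-- If two closed sets cover `X` and are disjoint on `X`, then a connected component of `X` lies in
one of them. -/
theorem connectedComponentIn_subset_of_isClosed {P : Type*} [TopologicalSpace P] {X K K' : Set P}
    (hK : IsClosed K) (hK' : IsClosed K') (hX : X ⊆ K ∪ K') (hd : ∀ q ∈ X, q ∈ K → q ∉ K') {p : P}
    (hp : p ∈ K) : connectedComponentIn X p ⊆ K := by
  by_cases hpX : p ∈ X
  · have hc : IsPreconnected (connectedComponentIn X p) := isPreconnected_connectedComponentIn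
    rw [isPreconnected_closed_iff] at hc
    intro q hq
    by_contra hqK
    have hqX := connectedComponentIn_subset X p hq
    obtain ⟨r, hr, hr1, hr2⟩ := hc K K' hK hK' ((connectedComponentIn_subset X p).trans hX)
      ⟨p, mem_connectedComponentIn hpX, hp⟩ ⟨q, hq, (hX hqX).resolve_left hqK⟩
    exact hd r (connectedComponentIn_subset X p hr) hr1 hr2
  · rw [connectedComponentIn_eq_empty hpX]
    exact Set.empty_subset _

/-! ### Sides and vertices as subsets of the surface -/

namespace PolygonSubdivision

variable {m : ℕ} {P : Type u} [TopologicalSpace P] {F : Type v} {D : PolygonSubdivision m P F}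

/-- The midpoint of a side lies on no other side than this one and its mate. -/
theorem side_eq_iff {s t : F × Fin (m + 2)} : D.side s = D.side t ↔ t = s ∨ t = D.mate s := by
  refine ⟨fun h => ?_, ?_⟩
  · let c : unitInterval := ⟨1 / 2, by norm_num, by norm_num⟩
    have hc : D.χ s.1 (sidePoint s.2 c) ∈ D.side t := h ▸ ⟨c, rfl⟩
    obtain ⟨v, hv⟩ := hc
    exact (eq_or_eq_of_χ_eq (by norm_num [c]) (by norm_num [c]) hv.symm).imp And.left And.left
  · rintro (rfl | rfl)
    · rfl
    · exact (D.side_mate s).symm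

theorem side_mem_arcs_iff {s : F × Fin (m + 2)} : D.side s ∈ D.arcs ↔ D.IsArc s := by
  refine ⟨?_, fun h => ⟨s, h, rfl⟩⟩
  rintro ⟨t, ht, h⟩
  rcases side_eq_iff.1 h with rfl | rfl
  · exact ht
  · exact isArc_mate.1 ht

theorem continuous_sidePoint {N : ℕ} (j : Fin N) : Continuous (sidePoint j) := by
  unfold sidePoint
  fun_prop

variable (D) in
theorem continuous_χ_sidePoint (s : F × Fin (m + 2)) :
    Continuous fun u => D.χ s.1 (sidePoint s.2 u) :=
  (D.continuous_χ _).comp (continuous_sidePoint _)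

variable (D) in
theorem isCompact_side (s : F × Fin (m + 2)) : IsCompact (D.side s) :=
  isCompact_range (D.continuous_χ_sidePoint s)

variable (D) in
theorem isPreconnected_side (s : F × Fin (m + 2)) : IsPreconnected (D.side s) :=
  isPreconnected_range (D.continuous_χ_sidePoint s)

variable (D) in
theorem side_subset_polygon (s : F × Fin (m + 2)) : D.side s ⊆ D.polygon s.1 := by
  rintro _ ⟨u, rfl⟩
  exact ⟨_, rfl⟩

variable (D) in
/-- The midpoint of a side. -/
noncomputable def mid (s : F × Fin (m + 2)) : P :=
  D.χ s.1 (sidePoint s.2 ⟨1 / 2, by norm_num, by norm_num⟩)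

/-- A common point of a boundary side with another side is a vertex. -/
theorem eq_corner_of_mem_side {s t : F × Fin (m + 2)} (hs : ¬ D.IsArc s) {p : P}
    (hp : p ∈ D.side s) (hp' : p ∈ D.side t) (hst : s ≠ t) :
    p = D.corner s ∨ p = D.corner (next s) := by
  obtain ⟨u, rfl⟩ := hp
  obtain ⟨v, hv⟩ := hp'
  rcases eq_or_lt_of_le u.2.1 with h0 | h0
  · left
    have : u = 0 := Subtype.ext h0.symm
    subst this
    rfl
  rcases eq_or_lt_of_le u.2.2 with h1 | h1
  · right
    have : u = 1 := Subtype.ext h1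
    subst this
    exact D.χ_one s
  · exfalso
    have hm : D.mate s = s := not_not.1 hs
    rcases eq_or_eq_of_χ_eq h0 h1 hv.symm with h | h
    · exact hst h.1.symm
    · exact hst (h.1.trans hm).symm

theorem corner_mem_side_iff {s t : F × Fin (m + 2)} :
    D.corner s ∈ D.side t ↔ D.corner s = D.corner t ∨ D.corner s = D.corner (next t) := by
  constructor
  · rintro ⟨u, hu⟩
    rcases eq_or_lt_of_le u.2.1 with h0 | h0
    · left
      have : u = 0 := Subtype.ext h0.symm
      subst this
      exact hu.symm
    rcases eq_or_lt_of_le u.2.2 with h1 | h1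
    · right
      have : u = 1 := Subtype.ext h1
      subst this
      rw [← D.χ_one t]
      exact hu.symm
    · exfalso
      rcases eq_or_eq_of_χ_eq h0 h1 hu with ⟨-, h⟩ | ⟨-, h⟩
      · rw [← h] at h0
        simp at h0
      · have := congrArg Subtype.val h
        rw [unitInterval.coe_symm_eq, Set.Icc.coe_zero] at this
        linarith
  · rintro (h | h)
    · rw [h]; exact D.corner_mem_side t
    · rw [h]; exact D.corner_next_mem_side t

theorem corner_mem_boundary_iff {s : F × Fin (m + 2)} :
    D.corner s ∈ D.boundary ↔ ∃ t, ¬ D.IsArc t ∧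
      (D.corner s = D.corner t ∨ D.corner s = D.corner (D.rot t)) := by
  constructor
  · rintro ⟨t, ht, h⟩
    have ht : ¬ D.IsArc t := not_not.2 ht
    exact ⟨t, ht, by rw [rot_of_not_isArc ht]; exact corner_mem_side_iff.1 h⟩
  · rintro ⟨t, ht, h⟩
    rw [rot_of_not_isArc ht] at h
    exact ⟨t, not_not.1 ht, corner_mem_side_iff.2 h⟩

/-! ### Absence of punctures and of polygons without arcs; the points of M_T -/

variable (D) in
/-- Without punctures, every orbit of the rotation contains a boundary side. -/
def NoPuncture : Prop := ∀ s, ∃ n : ℕ, ¬ D.IsArc ((D.rot ^ n) s)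

variable (D) in
/-- Every polygon has a side that is an arc. -/
def NoIsolated : Prop := ∀ f, ∃ j, D.IsArc (f, j)

/-- Corners with the same image lie in one orbit of `rot`, and on a finite set all of an orbit is
reached by forward powers. -/
theorem noPuncture_of_marked_subset [Finite F] (h : D.marked ⊆ D.boundary) : D.NoPuncture := by
  intro s
  obtain ⟨t, ht, h⟩ := corner_mem_boundary_iff.1 (h ⟨s, rfl⟩)
  have : D.rot.SameCycle s t := by
    rcases h with h | h
    · exact sameCycle_of_corner_eq h
    · exact Equiv.Perm.sameCycle_apply_right.1 (sameCycle_of_corner_eq h)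
  obtain ⟨n, hn⟩ := this.exists_nat_pow_eq
  exact ⟨n, hn ▸ ht⟩

variable (D) in
theorem isClosed_polygon [T2Space P] (f : F) : IsClosed (D.polygon f) :=
  (isCompact_range (D.continuous_χ f)).isClosed

/-- A polygon without arcs is disjoint from the others, and all of them are closed and finite in
number. So the component of any of its points stays inside it and meets no arc. -/
theorem noIsolated_of_arcs [T2Space P] [Finite F]
    (hT : ∀ p : P, ∃ τ ∈ D.arcs, (τ ∩ connectedComponent p).Nonempty) : D.NoIsolated := by
  intro f
  by_contra! hf
  have key : ∀ z f' z', D.χ f z = D.χ f' z' → f' = f := by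
    intro z f' z' h
    refine (Relation.EqvGen.iff_of_forall (p := fun x => x.1 = f) ?_
      ((D.χ_eq_χ_iff _ _ _ _).1 h)).1 rfl
    rintro _ _ ⟨s, hs, u⟩
    have h1 : s.1 ≠ f := fun h => hf s.2 (by rw [← h]; exact hs)
    have h2 : (D.mate s).1 ≠ f := fun h => hf (D.mate s).2 (by
      rw [← h]; exact isArc_mate.2 hs)
    exact iff_of_false h1 h2
  let z : PolygonModel := ⟨0, by simp⟩
  obtain ⟨_, ⟨s, hs, rfl⟩, q, hq, hqc⟩ := hT (D.χ f z)
  rw [← connectedComponentIn_univ] at hqc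
  have := connectedComponentIn_subset_of_isClosed (X := Set.univ) (K := D.polygon f)
    (K' := ⋃ f' ∈ {f' | f' ≠ f}, D.polygon f') (D.isClosed_polygon f)
    (Set.Finite.isClosed_biUnion (Set.toFinite _) fun f' _ => D.isClosed_polygon f') ?_ ?_
    ⟨z, rfl⟩ hqc
  · obtain ⟨w, rfl⟩ := this
    obtain ⟨u, hu⟩ := hq
    exact hf s.2 (by rw [← key _ _ _ hu.symm]; exact hs)
  · intro p _
    obtain ⟨f', z, rfl⟩ := D.exists_χ_eq p
    by_cases h : f' = f
    · exact Or.inl ⟨z, by rw [h]⟩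
    · exact Or.inr (Set.mem_biUnion (x := f') h ⟨z, rfl⟩)
  · rintro _ - ⟨z, rfl⟩ h
    simp only [Set.mem_iUnion] at h
    obtain ⟨f', hf', z', h⟩ := h
    exact hf' (key _ _ _ h.symm)

variable (D) in
/-- The glued sides that come first in counter-clockwise order around their initial vertex, in
which case the preceding side of their polygon lies on the boundary. -/
def starts : Set (F × Fin (m + 2)) := {c | D.IsArc c ∧ ¬ D.IsArc (prev c)}

/-- The predecessor of `c` under `rot` is the boundary side `prev c`, so crossing arcs leads from
`c` only forwards; every side reached after `c` has an arc as predecessor. Thus at most one boundary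
side ends at a given vertex. -/
theorem corner_injOn : Set.InjOn D.corner {c | ¬ D.IsArc (prev c)} := by
  intro c hc c' hc' h
  let R : F × Fin (m + 2) → Prop := fun s => ∃ k : ℕ, (D.rot ^ k) c = s ∧
    ∀ i < k, D.IsArc ((D.rot ^ i) c)
  have hR : ∀ a b, D.IsArc a ∧ b = D.rot a → (R a ↔ R b) := by
    rintro a _ ⟨ha, rfl⟩
    constructor
    · rintro ⟨k, rfl, hk⟩
      refine ⟨k + 1, by rw [pow_succ', Equiv.Perm.mul_apply], fun i hi => ?_⟩
      rcases Nat.lt_succ_iff_lt_or_eq.1 hi with hi | rfl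
      · exact hk i hi
      · exact ha
    · rintro ⟨k, h1, hk⟩
      rcases k with _ | k
      · exfalso
        rw [pow_zero, Equiv.Perm.one_apply] at h1
        rw [h1, Set.mem_ofPred_eq, ← isArc_rot_symm, Equiv.symm_apply_apply] at hc
        exact hc ha
      · rw [pow_succ', Equiv.Perm.mul_apply] at h1
        exact ⟨k, D.rot.injective h1, fun i hi => hk i (by omega)⟩
  obtain ⟨k, h1, hk⟩ := (Relation.EqvGen.iff_of_forall hR (eqvGen_of_corner_eq h)).1
    ⟨0, rfl, fun i hi => absurd hi (Nat.not_lt_zero i)⟩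
  rcases k with _ | k
  · exact h1
  · exfalso
    rw [pow_succ', Equiv.Perm.mul_apply] at h1
    rw [Set.mem_ofPred_eq, ← h1, ← isArc_rot_symm, Equiv.symm_apply_apply] at hc'
    exact hc' (hk k (by omega))

theorem corner_mem_markedT_iff {s : F × Fin (m + 2)} :
    D.corner s ∈ D.markedT ↔ ∃ t, D.IsArc t ∧ D.corner s = D.corner t := by
  constructor
  · rintro ⟨-, _, ⟨t, ht, rfl⟩, h⟩
    rcases corner_mem_side_iff.1 h with h | h
    · exact ⟨t, ht, h⟩
    · refine ⟨D.mate t, isArc_mate.2 ht, ?_⟩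
      rw [h, ← corner_rot (isArc_mate.2 ht), rot_apply, D.mate_mate]
  · rintro ⟨t, ht, h⟩
    exact ⟨⟨s, rfl⟩, _, ⟨t, ht, rfl⟩, h ▸ D.corner_mem_side t⟩

/-- Rotate backwards and stop just before the first boundary side, which exists in the absence of
punctures. -/
theorem exists_mem_starts_corner_eq [Finite F] (hP : D.NoPuncture) {s : F × Fin (m + 2)}
    (hs : D.IsArc s) : ∃ c ∈ D.starts, D.corner c = D.corner s := by
  classical
  have hex : ∃ n : ℕ, ¬ D.IsArc ((D.rot.symm ^ n) s) := by
    obtain ⟨n, hn⟩ := hP s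
    have : D.rot.SameCycle s ((D.rot ^ n) s) := ⟨n, rfl⟩
    rw [← Equiv.Perm.sameCycle_inv] at this
    obtain ⟨k, hk⟩ := this.exists_nat_pow_eq
    exact ⟨k, by rw [← Equiv.Perm.inv_def, hk]; exact hn⟩
  have hpos : Nat.find hex ≠ 0 := fun h => by
    have := Nat.find_spec hex
    rw [h] at this
    exact this hs
  obtain ⟨k, hk⟩ := Nat.exists_eq_succ_of_ne_zero hpos
  have hmin : ∀ i ≤ k, D.IsArc ((D.rot.symm ^ i) s) := fun i hi =>
    not_not.1 (Nat.find_min hex (m := i) (by omega))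
  have hlast := Nat.find_spec hex
  rw [hk, pow_succ', Equiv.Perm.mul_apply, isArc_rot_symm] at hlast
  refine ⟨(D.rot.symm ^ k) s, ⟨hmin k le_rfl, hlast⟩, ?_⟩
  clear hlast hk
  induction k with
  | zero => rfl
  | succ k ih =>
    rw [← ih fun i hi => hmin i (by omega)]
    have := corner_rot (hmin (k + 1) le_rfl)
    rw [pow_succ', Equiv.Perm.mul_apply, Equiv.apply_symm_apply] at this
    rw [pow_succ', Equiv.Perm.mul_apply, this]

theorem markedT_eq [Finite F] (hP : D.NoPuncture) : D.markedT = D.corner '' D.starts := by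
  ext p
  constructor
  · intro hp
    obtain ⟨s, rfl⟩ := hp.1
    obtain ⟨t, ht, h⟩ := corner_mem_markedT_iff.1 hp
    obtain ⟨c, hc, hc'⟩ := exists_mem_starts_corner_eq hP ht
    exact ⟨c, hc, hc'.trans h.symm⟩
  · rintro ⟨c, hc, rfl⟩
    exact corner_mem_markedT_iff.2 ⟨c, hc.1, rfl⟩

theorem corner_notMem_markedT [Finite F] (hP : D.NoPuncture) {s : F × Fin (m + 2)}
    (h : ¬ D.IsArc s) (h' : ¬ D.IsArc (prev s)) : D.corner s ∉ D.markedT := by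
  rw [markedT_eq hP]
  rintro ⟨c, hc, hcs⟩
  rw [corner_injOn hc.2 h' hcs] at hc
  exact h hc.1

theorem not_isArc_of_corner_notMem {s : F × Fin (m + 2)} (h : D.corner s ∉ D.markedT) :
    ¬ D.IsArc s ∧ ¬ D.IsArc (prev s) := by
  rw [corner_mem_markedT_iff] at h
  push Not at h
  refine ⟨fun hs => h s hs rfl, fun hs => ?_⟩
  rw [← isArc_rot_symm] at hs
  exact h _ hs (by rw [← corner_rot hs, Equiv.apply_symm_apply])

end PolygonSubdivision

/-! ### Boundary components and boundary segments -/

namespace PolygonSubdivision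

variable {m : ℕ} {P : Type u} [TopologicalSpace P] {F : Type v} {D : PolygonSubdivision m P F}

theorem side_subset_boundary {s : F × Fin (m + 2)} (hs : ¬ D.IsArc s) : D.side s ⊆ D.boundary :=
  fun _ hp => ⟨s, not_not.1 hs, hp⟩

theorem mem_boundary_iff {p : P} : p ∈ D.boundary ↔ ∃ s, ¬ D.IsArc s ∧ p ∈ D.side s := by
  simp [boundary, IsArc]

theorem sameCycle_rot (s : F × Fin (m + 2)) : D.rot.SameCycle s (D.rot s) :=
  Equiv.Perm.sameCycle_apply_right.2 (Equiv.Perm.SameCycle.refl _ _)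

variable (D) in
/-- The union of the boundary sides in the orbit of `c` under the rotation. -/
def bdryCycle (c : F × Fin (m + 2)) : Set P :=
  ⋃ s ∈ {s | ¬ D.IsArc s ∧ D.rot.SameCycle c s}, D.side s

theorem mem_bdryCycle {c : F × Fin (m + 2)} {p : P} :
    p ∈ D.bdryCycle c ↔ ∃ s, ¬ D.IsArc s ∧ D.rot.SameCycle c s ∧ p ∈ D.side s := by
  simp [bdryCycle, and_assoc]

theorem sameCycle_of_mem_side {s t : F × Fin (m + 2)} (hs : ¬ D.IsArc s) (ht : ¬ D.IsArc t) {p : P}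
    (hp : p ∈ D.side s) (hp' : p ∈ D.side t) : D.rot.SameCycle s t := by
  by_cases hst : s = t
  · rw [hst]
  have h1 := eq_corner_of_mem_side hs hp hp' hst
  have h2 := eq_corner_of_mem_side ht hp' hp (Ne.symm hst)
  rw [← rot_of_not_isArc hs] at h1
  rw [← rot_of_not_isArc ht] at h2
  obtain ⟨s', hs', hps⟩ : ∃ s', D.rot.SameCycle s s' ∧ p = D.corner s' := by
    rcases h1 with h | h
    · exact ⟨s, .refl _ _, h⟩
    · exact ⟨_, sameCycle_rot s, h⟩
  obtain ⟨t', ht', hpt⟩ : ∃ t', D.rot.SameCycle t t' ∧ p = D.corner t' := by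
    rcases h2 with h | h
    · exact ⟨t, .refl _ _, h⟩
    · exact ⟨_, sameCycle_rot t, h⟩
  exact hs'.trans ((sameCycle_of_corner_eq (hps.symm.trans hpt)).trans ht'.symm)

theorem connectedComponentIn_eq_of_mem {X A : Set P} (hA : IsPreconnected A) (hAX : A ⊆ X) {p q : P}
    (hp : p ∈ A) (hq : q ∈ A) : connectedComponentIn X p = connectedComponentIn X q :=
  connectedComponentIn_eq (hA.subset_connectedComponentIn hp hAX hq)

/-- Consecutive members of an orbit have corners in the same component, which gives connectedness.
Conversely, boundary sides in different orbits are disjoint, and finite unions of compact sides are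
closed. -/
theorem connectedComponentIn_boundary_eq [T2Space P] [Finite F] {c : F × Fin (m + 2)} {p : P}
    (hp : p ∈ D.bdryCycle c) : connectedComponentIn D.boundary p = D.bdryCycle c := by
  have hside : ∀ s, ¬ D.IsArc s → ∀ q ∈ D.side s, connectedComponentIn D.boundary q =
      connectedComponentIn D.boundary (D.corner s) := fun s hs q hq =>
    connectedComponentIn_eq_of_mem (D.isPreconnected_side s) (side_subset_boundary hs) hq
      (D.corner_mem_side s)
  have hrot : ∀ s, connectedComponentIn D.boundary (D.corner (D.rot s)) =
      connectedComponentIn D.boundary (D.corner s) := by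
    intro s
    by_cases hs : D.IsArc s
    · rw [corner_rot hs]
    · rw [rot_of_not_isArc hs]
      exact hside s hs _ (D.corner_next_mem_side s)
  have hcyc : ∀ s t, D.rot.SameCycle s t → connectedComponentIn D.boundary (D.corner t) =
      connectedComponentIn D.boundary (D.corner s) := by
    intro s t h
    obtain ⟨n, rfl⟩ := h.exists_nat_pow_eq
    clear h
    induction n with
    | zero => rfl
    | succ n ih => rw [pow_succ', Equiv.Perm.mul_apply, hrot, ih]
  obtain ⟨s, hs, hcs, hps⟩ := mem_bdryCycle.1 hp
  apply Set.Subset.antisymm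
  · refine connectedComponentIn_subset_of_isClosed
      (K' := ⋃ t ∈ {t | ¬ D.IsArc t ∧ ¬ D.rot.SameCycle c t}, D.side t)
      (Set.Finite.isClosed_biUnion (Set.toFinite _) fun t _ => (D.isCompact_side t).isClosed)
      (Set.Finite.isClosed_biUnion (Set.toFinite _) fun t _ => (D.isCompact_side t).isClosed)
      ?_ ?_ hp
    · intro q hq
      obtain ⟨t, ht, hqt⟩ := mem_boundary_iff.1 hq
      by_cases h : D.rot.SameCycle c t
      · exact Or.inl (mem_bdryCycle.2 ⟨t, ht, h, hqt⟩)
      · exact Or.inr (Set.mem_biUnion (x := t) ⟨ht, h⟩ hqt)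
    · intro q _ hq hq'
      obtain ⟨t, ht, hct, hqt⟩ := mem_bdryCycle.1 hq
      simp only [Set.mem_iUnion] at hq'
      obtain ⟨t', ⟨ht', hct'⟩, hqt'⟩ := hq'
      exact hct' (hct.trans (sameCycle_of_mem_side ht ht' hqt hqt'))
  · intro q hq
    obtain ⟨t, ht, hct, hqt⟩ := mem_bdryCycle.1 hq
    rw [hside s hs p hps, hcyc t s (hct.symm.trans hcs), ← hside t ht q hqt]
    exact mem_connectedComponentIn (side_subset_boundary ht hqt)

variable (D) in
/-- Going around a polygon from `s`, with only boundary sides on the way, one gets to `d`. -/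
def Leads (s d : F × Fin (m + 2)) : Prop :=
  ∃ k : ℕ, (D.rot ^ k) s = d ∧ ∀ i < k, ¬ D.IsArc ((D.rot ^ i) s)

theorem Leads.sameCycle {s d : F × Fin (m + 2)} (h : D.Leads s d) : D.rot.SameCycle s d := by
  obtain ⟨k, rfl, -⟩ := h
  exact ⟨k, rfl⟩

theorem Leads.refl (d : F × Fin (m + 2)) : D.Leads d d :=
  ⟨0, rfl, fun i hi => absurd hi (Nat.not_lt_zero i)⟩

theorem leads_iff_rot {s d : F × Fin (m + 2)} (hs : ¬ D.IsArc s) (hd : D.IsArc d) :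
    D.Leads s d ↔ D.Leads (D.rot s) d := by
  constructor
  · rintro ⟨_ | k, h, hk⟩
    · exact absurd hd ((show s = d from h) ▸ hs)
    · refine ⟨k, by rwa [pow_succ, Equiv.Perm.mul_apply] at h, fun i hi => ?_⟩
      have := hk (i + 1) (by omega)
      rwa [pow_succ, Equiv.Perm.mul_apply] at this
  · rintro ⟨k, h, hk⟩
    refine ⟨k + 1, by rwa [pow_succ, Equiv.Perm.mul_apply], fun i hi => ?_⟩
    rcases i with _ | i
    · exact hs
    · rw [pow_succ, Equiv.Perm.mul_apply]
      exact hk i (by omega)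

/-- Induction along a run of boundary sides. -/
theorem Leads.induction {d : F × Fin (m + 2)} {p : F × Fin (m + 2) → Prop} (hd : p d)
    (hp : ∀ s, ¬ D.IsArc s → D.Leads (D.rot s) d → p (D.rot s) → p s) {s : F × Fin (m + 2)}
    (h : D.Leads s d) : p s := by
  obtain ⟨k, h, hk⟩ := h
  induction k generalizing s with
  | zero => rw [show s = d from h]; exact hd
  | succ k ih =>
    rw [pow_succ, Equiv.Perm.mul_apply] at h
    have hk' : ∀ i < k, ¬ D.IsArc ((D.rot ^ i) (D.rot s)) := fun i hi => by
      have := hk (i + 1) (by omega)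
      rwa [pow_succ, Equiv.Perm.mul_apply] at this
    exact hp s (hk 0 (by omega)) ⟨k, h, hk'⟩ (ih h hk')

theorem Leads.unique {s d d' : F × Fin (m + 2)} (h : D.Leads s d) (h' : D.Leads s d')
    (hd : D.IsArc d) (hd' : D.IsArc d') : d = d' := by
  revert h'
  refine Leads.induction (p := fun s => D.Leads s d' → d = d') ?_ ?_ h
  · rintro ⟨_ | k, h, hk⟩
    · exact h
    · exact absurd hd (hk 0 (by omega))
  · intro s hs _ ih h'
    exact ih ((leads_iff_rot hs hd').1 h')

/-- On boundary sides `rot` is `next`, so the walk never leaves its polygon. This is why a boundary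
segment lies in a single polygon. -/
theorem Leads.fst_eq {s d : F × Fin (m + 2)} (h : D.Leads s d) : d.1 = s.1 := by
  refine Leads.induction (p := fun s => d.1 = s.1) rfl ?_ h
  intro s hs _ h
  rw [h, rot_of_not_isArc hs, next_fst]

theorem Leads.mem_starts {s d : F × Fin (m + 2)} (h : D.Leads s d) (hs : ¬ D.IsArc s)
    (hd : D.IsArc d) : d ∈ D.starts := by
  revert hs
  refine Leads.induction (p := fun s => ¬ D.IsArc s → d ∈ D.starts) ?_ ?_ h
  · exact fun h => absurd hd h
  · intro s hs hl ih _
    by_cases h : D.IsArc (D.rot s)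
    · have := hl.unique (Leads.refl _) hd h
      rw [this, rot_of_not_isArc hs] at *
      refine ⟨h, by rwa [prev_next]⟩
    · exact ih h

/-- Going around the polygon, one must meet one of its arcs. -/
theorem exists_leads (hI : D.NoIsolated) {s : F × Fin (m + 2)} (hs : ¬ D.IsArc s) :
    ∃ d ∈ D.starts, D.Leads s d := by
  classical
  obtain ⟨j, hj⟩ := hI s.1
  obtain ⟨k, -, hk⟩ := exists_next_iterate_eq (s := s) (t := (s.1, j)) rfl
  have hex : ∃ k, D.IsArc (next^[k] s) := ⟨k, by rw [hk]; exact hj⟩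
  have hmin : ∀ i < Nat.find hex, ¬ D.IsArc (next^[i] s) := fun i hi => Nat.find_min hex hi
  have hpow : ∀ i ≤ Nat.find hex, (D.rot ^ i) s = next^[i] s := by
    intro i
    induction i with
    | zero => intro; rfl
    | succ i ih =>
      intro hi
      rw [pow_succ', Equiv.Perm.mul_apply, ih (by omega), Function.iterate_succ_apply',
        rot_of_not_isArc (hmin i (by omega))]
  have hl : D.Leads s (next^[Nat.find hex] s) :=
    ⟨_, hpow _ le_rfl, fun i hi => by rw [hpow i hi.le]; exact hmin i hi⟩
  exact ⟨_, hl.mem_starts hs (Nat.find_spec hex), hl⟩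

theorem leads_prev {d : F × Fin (m + 2)} (hd : d ∈ D.starts) : D.Leads (prev d) d := by
  rw [leads_iff_rot hd.2 hd.1, rot_of_not_isArc hd.2, next_prev]
  exact Leads.refl d

variable (D) in
/-- The boundary segment that ends at the initial vertex of `d`, without its endpoints. -/
def seg (d : F × Fin (m + 2)) : Set P :=
  (⋃ s ∈ {s | ¬ D.IsArc s ∧ D.Leads s d}, D.side s) \ D.markedT

theorem mem_seg {d : F × Fin (m + 2)} {p : P} :
    p ∈ D.seg d ↔ (∃ s, ¬ D.IsArc s ∧ D.Leads s d ∧ p ∈ D.side s) ∧ p ∉ D.markedT := by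
  simp [seg, and_assoc]

theorem mid_mem_side (s : F × Fin (m + 2)) : D.mid s ∈ D.side s := ⟨_, rfl⟩

theorem eq_of_mid_mem_side {s t : F × Fin (m + 2)} (hs : ¬ D.IsArc s) (h : D.mid s ∈ D.side t) :
    t = s := by
  obtain ⟨u, hu⟩ := h
  rcases eq_or_eq_of_χ_eq (by norm_num) (by norm_num) hu.symm with h | h
  · exact h.1
  · rw [h.1, not_not.1 hs]

theorem mid_notMem_markedT (s : F × Fin (m + 2)) : D.mid s ∉ D.markedT := by
  rintro ⟨⟨t, ht⟩, -⟩
  rcases eq_or_eq_of_χ_eq (by norm_num) (by norm_num) ht with ⟨-, h⟩ | ⟨-, h⟩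
  · have := congrArg Subtype.val h
    norm_num at this
  · have := congrArg Subtype.val h
    norm_num at this

theorem mid_mem_seg {s d : F × Fin (m + 2)} (hs : ¬ D.IsArc s) (h : D.Leads s d) :
    D.mid s ∈ D.seg d :=
  mem_seg.2 ⟨⟨s, hs, h, mid_mem_side s⟩, mid_notMem_markedT s⟩

/-- Distinct boundary sides meet only in vertices. At a vertex outside M_T both walks pass through a
side that begins there and is preceded by a boundary side; by `corner_injOn` there is only one such
side. -/
theorem leads_eq_of_mem_side {s t d d' : F × Fin (m + 2)} (hs : ¬ D.IsArc s) (ht : ¬ D.IsArc t)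
    (hd : D.IsArc d) (hd' : D.IsArc d') (hsd : D.Leads s d) (htd : D.Leads t d') {p : P}
    (hp : p ∈ D.side s) (hp' : p ∈ D.side t) (hpM : p ∉ D.markedT) : d = d' := by
  by_cases hst : s = t
  · rw [hst] at hsd
    exact hsd.unique htd hd hd'
  have h1 := eq_corner_of_mem_side hs hp hp' hst
  have h2 := eq_corner_of_mem_side ht hp' hp (Ne.symm hst)
  rw [← rot_of_not_isArc hs] at h1
  rw [← rot_of_not_isArc ht] at h2
  obtain ⟨s', hs', hps⟩ : ∃ s', D.Leads s' d ∧ p = D.corner s' := by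
    rcases h1 with h | h
    · exact ⟨s, hsd, h⟩
    · exact ⟨_, (leads_iff_rot hs hd).1 hsd, h⟩
  obtain ⟨t', ht', hpt⟩ : ∃ t', D.Leads t' d' ∧ p = D.corner t' := by
    rcases h2 with h | h
    · exact ⟨t, htd, h⟩
    · exact ⟨_, (leads_iff_rot ht hd').1 htd, h⟩
  have a1 := not_isArc_of_corner_notMem (hps ▸ hpM)
  have a2 := not_isArc_of_corner_notMem (hpt ▸ hpM)
  have := corner_injOn a1.2 a2.2 (hps.symm.trans hpt)
  rw [this] at hs'
  exact hs'.unique ht' hd hd'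

theorem seg_disjoint {d d' : F × Fin (m + 2)} (hd : D.IsArc d) (hd' : D.IsArc d') {p : P}
    (hp : p ∈ D.seg d) (hp' : p ∈ D.seg d') : d = d' := by
  obtain ⟨⟨s, hs, hsd, hps⟩, hpM⟩ := mem_seg.1 hp
  obtain ⟨⟨t, ht, htd, hpt⟩, -⟩ := mem_seg.1 hp'
  exact leads_eq_of_mem_side hs ht hd hd' hsd htd hps hpt hpM

theorem seg_injOn : Set.InjOn D.seg D.starts := by
  intro d hd d' hd' h
  exact seg_disjoint hd.1 hd'.1 (mid_mem_seg hd.2 (leads_prev hd))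
    (h ▸ mid_mem_seg hd.2 (leads_prev hd))

theorem seg_subset_polygon (d : F × Fin (m + 2)) : D.seg d ⊆ D.polygon d.1 := by
  intro p hp
  obtain ⟨⟨s, hs, hsd, hps⟩, hpM⟩ := mem_seg.1 hp
  rw [hsd.fst_eq]
  exact D.side_subset_polygon s hps

/-- Only end points of a side can be marked, so what remains is the image of an interval. -/
theorem isPreconnected_side_diff {s : F × Fin (m + 2)} :
    IsPreconnected (D.side s \ D.markedT) := by
  have : D.side s \ D.markedT = (fun u => D.χ s.1 (sidePoint s.2 u)) ''
      {u | D.χ s.1 (sidePoint s.2 u) ∉ D.markedT} := by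
    ext p
    constructor
    · rintro ⟨⟨u, rfl⟩, h⟩
      exact ⟨u, h, rfl⟩
    · rintro ⟨u, h, rfl⟩
      exact ⟨⟨u, rfl⟩, h⟩
  rw [this]
  refine IsPreconnected.image (Set.OrdConnected.isPreconnected ⟨?_⟩) _
    (D.continuous_χ_sidePoint s).continuousOn
  intro a ha b hb u hu
  rcases eq_or_lt_of_le hu.1 with rfl | h1
  · exact ha
  rcases eq_or_lt_of_le hu.2 with rfl | h2
  · exact hb
  have h0 : 0 < (u : ℝ) := lt_of_le_of_lt a.2.1 h1
  have h1 : (u : ℝ) < 1 := lt_of_lt_of_le h2 b.2.2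
  rintro ⟨⟨t, ht⟩, -⟩
  rcases eq_or_eq_of_χ_eq h0 h1 ht with ⟨-, h⟩ | ⟨-, h⟩
  · rw [← h] at h0
    simp at h0
  · have := congrArg Subtype.val h
    rw [unitInterval.coe_symm_eq, Set.Icc.coe_zero] at this
    linarith

/-- This parallels the argument for boundary components, with `Leads` in place of orbits. The two
closed unions of sides may meet in M_T, but not in the rest of the boundary, which is all that is
needed. -/
theorem connectedComponentIn_segment_eq [T2Space P] [Finite F] (hP : D.NoPuncture)
    (hI : D.NoIsolated) {d : F × Fin (m + 2)} (hd : D.IsArc d) {p : P} (hp : p ∈ D.seg d) :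
    connectedComponentIn (D.boundary \ D.markedT) p = D.seg d := by
  set X := D.boundary \ D.markedT with hX
  have hsub : ∀ s, ¬ D.IsArc s → D.side s \ D.markedT ⊆ X := fun s hs =>
    Set.sdiff_subset_sdiff_left (side_subset_boundary hs)
  have hside : ∀ s, ¬ D.IsArc s → ∀ q ∈ D.side s, q ∉ D.markedT → connectedComponentIn X q =
      connectedComponentIn X (D.mid s) := fun s hs q hq hqM =>
    connectedComponentIn_eq_of_mem isPreconnected_side_diff (hsub s hs) ⟨hq, hqM⟩
      ⟨mid_mem_side s, mid_notMem_markedT s⟩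
  have hlead : ∀ s, D.Leads s d → ¬ D.IsArc s → connectedComponentIn X (D.mid s) =
      connectedComponentIn X (D.mid (prev d)) := by
    intro s h
    refine Leads.induction (p := fun s => ¬ D.IsArc s → connectedComponentIn X (D.mid s) =
      connectedComponentIn X (D.mid (prev d))) ?_ ?_ h
    · exact fun h => absurd hd h
    · intro s hs hl ih _
      by_cases h : D.IsArc (D.rot s)
      · have := hl.unique (Leads.refl _) hd h
        rw [this, rot_of_not_isArc hs, prev_next]
      · rw [← ih h]
        rw [rot_of_not_isArc hs] at h ⊢
        have hM := corner_notMem_markedT hP h (by rwa [prev_next])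
        rw [← hside s hs _ (D.corner_next_mem_side s) hM,
          ← hside _ h _ (D.corner_mem_side _) hM]
  obtain ⟨⟨s, hs, hsd, hps⟩, hpM⟩ := mem_seg.1 hp
  apply Set.Subset.antisymm
  · intro q hq
    refine ⟨?_, (connectedComponentIn_subset X p hq).2⟩
    refine connectedComponentIn_subset_of_isClosed
      (K' := ⋃ t ∈ {t | ¬ D.IsArc t ∧ ¬ D.Leads t d}, D.side t)
      (Set.Finite.isClosed_biUnion (Set.toFinite _) fun t _ => (D.isCompact_side t).isClosed)
      (Set.Finite.isClosed_biUnion (Set.toFinite _) fun t _ => (D.isCompact_side t).isClosed)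
      ?_ ?_ hp.1 hq
    · intro q hq
      obtain ⟨t, ht, hqt⟩ := mem_boundary_iff.1 hq.1
      by_cases h : D.Leads t d
      · exact Or.inl (Set.mem_biUnion (x := t) ⟨ht, h⟩ hqt)
      · exact Or.inr (Set.mem_biUnion (x := t) ⟨ht, h⟩ hqt)
    · intro q hqX hq hq'
      simp only [Set.mem_iUnion] at hq hq'
      obtain ⟨t, ⟨ht, htd⟩, hqt⟩ := hq
      obtain ⟨t', ⟨ht', htd'⟩, hqt'⟩ := hq'
      obtain ⟨d', hd', hl⟩ := exists_leads hI ht'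
      rw [← leads_eq_of_mem_side ht ht' hd hd'.1 htd hl hqt hqt' hqX.2] at hl
      exact htd' hl
  · intro q hq
    obtain ⟨⟨t, ht, htd, hqt⟩, hqM⟩ := mem_seg.1 hq
    rw [hside s hs p hps hpM, hlead s hsd hs, ← hlead t htd ht, ← hside t ht q hqt hqM]
    exact mem_connectedComponentIn ⟨side_subset_boundary ht hqt, hqM⟩

theorem segments_eq [T2Space P] [Finite F] (hP : D.NoPuncture) (hI : D.NoIsolated) :
    D.segments = D.seg '' D.starts := by
  ext b
  constructor
  · rintro ⟨p, hp, rfl⟩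
    obtain ⟨s, hs, hps⟩ := mem_boundary_iff.1 hp.1
    obtain ⟨d, hd, hl⟩ := exists_leads hI hs
    exact ⟨d, hd, (connectedComponentIn_segment_eq hP hI hd.1
      (mem_seg.2 ⟨⟨s, hs, hl, hps⟩, hp.2⟩)).symm⟩
  · rintro ⟨d, hd, rfl⟩
    have h := mid_mem_seg hd.2 (leads_prev hd)
    exact ⟨_, ⟨side_subset_boundary hd.2 (mid_mem_side _), h.2⟩,
      (connectedComponentIn_segment_eq hP hI hd.1 h).symm⟩

theorem boundaryComponents_eq [T2Space P] [Finite F] (hI : D.NoIsolated) :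
    D.boundaryComponents = D.bdryCycle '' D.starts := by
  ext C
  constructor
  · rintro ⟨p, hp, rfl⟩
    obtain ⟨s, hs, hps⟩ := mem_boundary_iff.1 hp
    obtain ⟨d, hd, hl⟩ := exists_leads hI hs
    exact ⟨d, hd, (connectedComponentIn_boundary_eq
      (mem_bdryCycle.2 ⟨s, hs, hl.sameCycle.symm, hps⟩)).symm⟩
  · rintro ⟨d, hd, rfl⟩
    have h : D.mid (prev d) ∈ D.bdryCycle d :=
      mem_bdryCycle.2 ⟨_, hd.2, (leads_prev hd).sameCycle.symm, mid_mem_side _⟩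
    exact ⟨_, side_subset_boundary hd.2 (mid_mem_side _),
      (connectedComponentIn_boundary_eq h).symm⟩

theorem mid_prev_mem_bdryCycle_iff {c d : F × Fin (m + 2)} (hd : d ∈ D.starts) :
    D.mid (prev d) ∈ D.bdryCycle c ↔ D.rot.SameCycle c d := by
  rw [mem_bdryCycle]
  constructor
  · rintro ⟨s, -, hcs, hs⟩
    rw [eq_of_mid_mem_side hd.2 hs] at hcs
    exact hcs.trans (leads_prev hd).sameCycle
  · intro h
    exact ⟨_, hd.2, h.trans (leads_prev hd).sameCycle.symm, mid_mem_side _⟩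

theorem bdryCycle_eq_iff {c d : F × Fin (m + 2)} (hd : d ∈ D.starts) :
    D.bdryCycle c = D.bdryCycle d ↔ D.rot.SameCycle c d := by
  constructor
  · intro h
    rw [← mid_prev_mem_bdryCycle_iff hd, h, mid_prev_mem_bdryCycle_iff hd]
  · intro h
    ext p
    simp only [mem_bdryCycle]
    exact ⟨fun ⟨s, hs, hcs, hp⟩ => ⟨s, hs, h.symm.trans hcs, hp⟩,
      fun ⟨s, hs, hcs, hp⟩ => ⟨s, hs, h.trans hcs, hp⟩⟩

theorem seg_subset_bdryCycle_iff {c d : F × Fin (m + 2)} (hd : d ∈ D.starts) :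
    D.seg d ⊆ D.bdryCycle c ↔ D.rot.SameCycle c d := by
  constructor
  · intro h
    exact (mid_prev_mem_bdryCycle_iff hd).1 (h (mid_mem_seg hd.2 (leads_prev hd)))
  · intro h p hp
    obtain ⟨⟨s, hs, hsd, hps⟩, -⟩ := mem_seg.1 hp
    exact mem_bdryCycle.2 ⟨s, hs, h.trans hsd.sameCycle.symm, hps⟩

variable (D) in
/-- The elements of `D.starts` in the orbit of `c` under the rotation. -/
def orbitStarts (c : F × Fin (m + 2)) : Set (F × Fin (m + 2)) :=
  {d | d ∈ D.starts ∧ D.rot.SameCycle c d}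

theorem ncard_markedT_inter_bdryCycle [Finite F] (hP : D.NoPuncture) (c : F × Fin (m + 2)) :
    (D.markedT ∩ D.bdryCycle c).ncard = (D.orbitStarts c).ncard := by
  have : D.markedT ∩ D.bdryCycle c = D.corner '' D.orbitStarts c := by
    rw [markedT_eq hP]
    ext p
    constructor
    · rintro ⟨⟨d, hd, rfl⟩, h⟩
      obtain ⟨s, hs, hcs, h⟩ := mem_bdryCycle.1 h
      refine ⟨d, ⟨hd, hcs.trans ?_⟩, rfl⟩
      rcases corner_mem_side_iff.1 h with h | h
      · exact (sameCycle_of_corner_eq h).symm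
      · rw [← rot_of_not_isArc hs] at h
        exact (sameCycle_rot s).trans (sameCycle_of_corner_eq h).symm
    · rintro ⟨d, ⟨hd, hcd⟩, rfl⟩
      refine ⟨⟨d, hd, rfl⟩, mem_bdryCycle.2 ⟨prev d, hd.2,
        hcd.trans (leads_prev hd).sameCycle.symm, ?_⟩⟩
      have := D.corner_next_mem_side (prev d)
      rwa [next_prev] at this
  rw [this, Set.InjOn.ncard_image]
  exact corner_injOn.mono fun d hd => hd.1.2

/-- A marked point of the segment outside M_T is the corner of exactly one side that lies on the
boundary together with its predecessor, so such sides can be counted instead. -/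
theorem weight_seg [Finite F] (hP : D.NoPuncture) {d : F × Fin (m + 2)} (hd : D.IsArc d) :
    D.weight (D.seg d) = {s | ¬ D.IsArc s ∧ ¬ D.IsArc (prev s) ∧ D.Leads s d}.ncard := by
  have : (D.marked ∩ D.seg d) \ D.markedT =
      D.corner '' {s | ¬ D.IsArc s ∧ ¬ D.IsArc (prev s) ∧ D.Leads s d} := by
    ext p
    constructor
    · rintro ⟨⟨⟨s, rfl⟩, hseg⟩, hM⟩
      change D.corner s ∈ _ at hseg
      change D.corner s ∉ _ at hM
      have hs := not_isArc_of_corner_notMem hM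
      refine ⟨s, ⟨hs.1, hs.2, ?_⟩, rfl⟩
      obtain ⟨⟨t, ht, htd, hst⟩, -⟩ := mem_seg.1 hseg
      rcases corner_mem_side_iff.1 hst with h | h
      · have h' := not_isArc_of_corner_notMem (h ▸ hM)
        rwa [corner_injOn hs.2 h'.2 h]
      · have h' := not_isArc_of_corner_notMem (h ▸ hM)
        rw [corner_injOn hs.2 h'.2 h, ← rot_of_not_isArc ht, ← leads_iff_rot ht hd]
        exact htd
    · rintro ⟨s, ⟨h1, h2, h3⟩, rfl⟩
      have hM := corner_notMem_markedT hP h1 h2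
      exact ⟨⟨⟨s, rfl⟩, mem_seg.2 ⟨⟨s, h1, h3, D.corner_mem_side s⟩, hM⟩⟩, hM⟩
  rw [weight, this, Set.InjOn.ncard_image]
  exact corner_injOn.mono fun s hs => hs.2.1

/-! ### Counting the angles of a polygon with a boundary segment -/

variable (D) in
/-- Every polygon contains at most one element of `D.starts`. -/
def AtMostOneStart : Prop := ∀ d ∈ D.starts, ∀ d' ∈ D.starts, d.1 = d'.1 → d = d'

variable (D) in
/-- The number of angles of the `f`-th polygon between consecutive arcs. -/
noncomputable def numAngles (f : F) : ℕ := {s | s.1 = f ∧ D.IsArc s ∧ D.IsArc (next s)}.ncard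

theorem ncard_polygon_sides (f : F) : {s : F × Fin (m + 2) | s.1 = f}.ncard = m + 2 := by
  have : {s : F × Fin (m + 2) | s.1 = f} = (fun j => (f, j)) '' Set.univ := by
    ext ⟨a, b⟩
    simp [eq_comm]
  rw [this, Set.ncard_image_of_injective _ (Prod.mk_right_injective f), Set.ncard_univ]
  simp

/-- By the shift `next`, there are as many boundary sides as sides preceded by one. Among the latter
the only arc is `d`, so there are w + 1 boundary sides. Similarly the arcs other than `d` correspond
to the angles. Together these are all m + 2 sides. -/
theorem weight_add_numAngles [Finite F] (hP : D.NoPuncture) (hI : D.NoIsolated)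
    (hS : D.AtMostOneStart) {d : F × Fin (m + 2)} (hd : d ∈ D.starts) :
    D.weight (D.seg d) + D.numAngles d.1 = m := by
  rw [weight_seg hP hd.1, numAngles]
  set f := d.1 with hf
  have h1 : {s | ¬ D.IsArc s ∧ ¬ D.IsArc (prev s) ∧ D.Leads s d} =
      {s | s.1 = f ∧ ¬ D.IsArc s ∧ ¬ D.IsArc (prev s)} := by
    ext s
    constructor
    · rintro ⟨a, b, c⟩
      exact ⟨c.fst_eq.symm, a, b⟩
    · rintro ⟨a, b, c⟩
      obtain ⟨d', hd', hl⟩ := exists_leads hI b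
      rw [hS d hd d' hd' (hl.fst_eq.trans a).symm]
      exact ⟨b, c, hl⟩
  have h2 : {s | s.1 = f ∧ D.IsArc s ∧ ¬ D.IsArc (prev s)} = {d} := by
    ext s
    constructor
    · rintro ⟨a, b⟩
      exact hS s b d hd a
    · rintro rfl
      exact ⟨rfl, hd⟩
  have h3 : {s | s.1 = f ∧ ¬ D.IsArc (prev s)} =
      {s | s.1 = f ∧ ¬ D.IsArc s ∧ ¬ D.IsArc (prev s)} ∪
      {s | s.1 = f ∧ D.IsArc s ∧ ¬ D.IsArc (prev s)} := by
    ext s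
    simp only [Set.mem_union, Set.mem_ofPred_eq]
    tauto
  have h4 : {s | s.1 = f ∧ D.IsArc s} =
      {s | s.1 = f ∧ D.IsArc s ∧ D.IsArc (prev s)} ∪
      {s | s.1 = f ∧ D.IsArc s ∧ ¬ D.IsArc (prev s)} := by
    ext s
    simp only [Set.mem_union, Set.mem_ofPred_eq]
    tauto
  have h5 : {s | s.1 = f ∧ D.IsArc s ∧ D.IsArc (prev s)} =
      next '' {s | s.1 = f ∧ D.IsArc s ∧ D.IsArc (next s)} := by
    ext s
    constructor
    · rintro ⟨a, b, c⟩
      exact ⟨prev s, ⟨a, c, by rwa [next_prev]⟩, next_prev s⟩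
    · rintro ⟨s, ⟨a, b, c⟩, rfl⟩
      exact ⟨a, c, by rwa [prev_next]⟩
  have h6 : {s | s.1 = f ∧ ¬ D.IsArc (prev s)} = next '' {s | s.1 = f ∧ ¬ D.IsArc s} := by
    ext s
    constructor
    · rintro ⟨a, b⟩
      exact ⟨prev s, ⟨a, b⟩, next_prev s⟩
    · rintro ⟨s, ⟨a, b⟩, rfl⟩
      exact ⟨a, by rwa [prev_next]⟩
  have h7 : {s : F × Fin (m + 2) | s.1 = f} = {s | s.1 = f ∧ D.IsArc s} ∪
      {s | s.1 = f ∧ ¬ D.IsArc s} := by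
    ext s
    simp only [Set.mem_union, Set.mem_ofPred_eq]
    tauto
  have c3 := congrArg Set.ncard h3
  have c4 := congrArg Set.ncard h4
  have c5 := congrArg Set.ncard h5
  have c6 := congrArg Set.ncard h6
  have c7 := congrArg Set.ncard h7
  rw [Set.ncard_union_eq (Set.disjoint_left.2 fun s hs hs' => hs.2.1 hs'.2.1) (Set.toFinite _)
    (Set.toFinite _), h2, Set.ncard_singleton] at c3
  rw [Set.ncard_union_eq (Set.disjoint_left.2 fun s hs hs' => hs'.2.2 hs.2.2) (Set.toFinite _)
    (Set.toFinite _), h2, Set.ncard_singleton] at c4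
  rw [Set.ncard_image_of_injective _ next_injective] at c5 c6
  rw [Set.ncard_union_eq (Set.disjoint_left.2 fun s hs hs' => hs'.2 hs.2) (Set.toFinite _)
    (Set.toFinite _), ncard_polygon_sides] at c7
  rw [h1]
  omega

theorem finsum_segments [T2Space P] [Finite F] (hP : D.NoPuncture) (hI : D.NoIsolated)
    (hS : D.AtMostOneStart) (c : F × Fin (m + 2)) :
    ∑ᶠ b ∈ {b | b ∈ D.segments ∧ b ⊆ D.bdryCycle c}, ((m : ℤ) - (D.weight b : ℤ)) =
      ((∑ᶠ d ∈ D.orbitStarts c, D.numAngles d.1 : ℕ) : ℤ) := by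
  have : {b | b ∈ D.segments ∧ b ⊆ D.bdryCycle c} = D.seg '' D.orbitStarts c := by
    rw [segments_eq hP hI]
    ext b
    constructor
    · rintro ⟨⟨d, hd, rfl⟩, h⟩
      exact ⟨d, ⟨hd, (seg_subset_bdryCycle_iff hd).1 h⟩, rfl⟩
    · rintro ⟨d, hd, rfl⟩
      exact ⟨⟨d, hd.1, rfl⟩, (seg_subset_bdryCycle_iff hd.1).2 hd.2⟩
  rw [this, finsum_mem_image (seg_injOn.mono fun d hd => hd.1),
    finsum_mem_eq_finite_toFinset_sum _ (Set.toFinite _),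
    finsum_mem_eq_finite_toFinset_sum _ (Set.toFinite _), Nat.cast_sum]
  refine Finset.sum_congr rfl fun d hd => ?_
  rw [Set.Finite.mem_toFinset] at hd
  have := weight_add_numAngles hP hI hS hd.1
  omega

end PolygonSubdivision

theorem Angulation.Nondegenerate.atMostOneStart {m : ℕ} {P : Type u} [TopologicalSpace P]
    [T2Space P] {F : Type v} [Finite F] {D : Angulation m P F} (hD : D.Nondegenerate)
    (hP : D.NoPuncture) (hI : D.NoIsolated) : D.AtMostOneStart := by
  intro d hd d' hd' h
  have hs := PolygonSubdivision.segments_eq hP hI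
  refine PolygonSubdivision.seg_injOn hd hd' (hD d.1 _ (hs ▸ ⟨d, hd, rfl⟩) _ (hs ▸ ⟨d', hd', rfl⟩)
    (PolygonSubdivision.seg_subset_polygon d) ?_)
  rw [h]
  exact PolygonSubdivision.seg_subset_polygon d'

/-- The generators have length two, so membership in the ideal is detected on consecutive arrows. -/
theorem BoundQuiver.isPermitted_iff {Q : BoundQuiver.{u, v}} {l : List Q.A} :
    Q.IsPermitted l ↔ l ≠ [] ∧ l.IsChain (fun α β => Q.tgt α = Q.src β ∧ ¬ Q.rel α β) := by
  constructor
  · rintro ⟨⟨h0, h1⟩, h2⟩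
    refine ⟨h0, ?_⟩
    rw [List.isChain_iff_getElem] at h1 ⊢
    refine fun i hi => ⟨h1 i hi, fun hr => h2 ⟨_, _, hr, ?_⟩⟩
    refine ⟨l.take i, l.drop (i + 2), ?_⟩
    rw [List.append_assoc, List.cons_append, List.cons_append, List.nil_append,
      ← List.drop_eq_getElem_cons hi, ← List.drop_eq_getElem_cons (by omega), List.take_append_drop]
  · rintro ⟨h0, h1⟩
    refine ⟨⟨h0, h1.imp fun _ _ h => h.1⟩, ?_⟩
    rintro ⟨α, β, hr, hi⟩
    have := h1.infix hi
    rw [List.isChain_pair] at this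
    exact this.2 hr

/-! ### The bound quiver in terms of sides -/

namespace PolygonSubdivision

variable {m : ℕ} {P : Type u} [TopologicalSpace P] {F : Type v} {D : PolygonSubdivision m P F}

/-- A glued side, as a vertex of the bound quiver. -/
def arcOf (s : F × Fin (m + 2)) (h : D.IsArc s) : D.boundQuiver.V := ⟨D.side s, s, h, rfl⟩

/-- The arrow of the bound quiver from a glued side to the next one. -/
def arrowOf (s : F × Fin (m + 2)) (h : D.IsArc s) (h' : D.IsArc (next s)) : D.boundQuiver.A :=
  ⟨s, ⟨s, h, rfl⟩, ⟨next s, h', rfl⟩⟩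

/-- The side from which an arrow of the bound quiver starts. -/
def sideOf (α : D.boundQuiver.A) : F × Fin (m + 2) :=
  (show {s : F × Fin (m + 2) // D.side s ∈ D.arcs ∧ D.side (next s) ∈ D.arcs} from α).1

@[simp] theorem sideOf_arrowOf (s : F × Fin (m + 2)) (h : D.IsArc s) (h' : D.IsArc (next s)) :
    sideOf (arrowOf s h h') = s := rfl

theorem sideOf_injective : Function.Injective (sideOf (D := D)) := Subtype.val_injective

theorem isArc_sideOf (α : D.boundQuiver.A) : D.IsArc (sideOf α) :=
  side_mem_arcs_iff.1 (Subtype.property α).1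

theorem isArc_next_sideOf (α : D.boundQuiver.A) : D.IsArc (next (sideOf α)) :=
  side_mem_arcs_iff.1 (Subtype.property α).2

theorem src_eq (α : D.boundQuiver.A) : D.boundQuiver.src α = arcOf (sideOf α) (isArc_sideOf α) :=
  rfl

theorem tgt_eq (α : D.boundQuiver.A) :
    D.boundQuiver.tgt α = arcOf (next (sideOf α)) (isArc_next_sideOf α) := rfl

theorem rel_iff {α β : D.boundQuiver.A} :
    D.boundQuiver.rel α β ↔ sideOf β = next (sideOf α) := Iff.rfl

theorem arcOf_eq_iff {s t : F × Fin (m + 2)} {h : D.IsArc s} {h' : D.IsArc t} :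
    arcOf s h = arcOf t h' ↔ t = s ∨ t = D.mate s := by
  rw [← side_eq_iff]
  exact Subtype.ext_iff

theorem arcOf_mate {s : F × Fin (m + 2)} (h : D.IsArc s) :
    arcOf (D.mate s) (isArc_mate.2 h) = arcOf s h := by
  rw [arcOf_eq_iff, D.mate_mate]
  exact Or.inr rfl

theorem exists_eq_arcOf (x : D.boundQuiver.V) : ∃ s h, x = arcOf (D := D) s h := by
  obtain ⟨_, s, h, rfl⟩ := x
  exact ⟨s, h, rfl⟩

/-- The target of `α` has two sides: an arrow continuing on `next (sideOf α)` stays in the polygon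
and gives a relation, one on the mate crosses the arc and gives none. -/
theorem comp_notMem_iff {α β : D.boundQuiver.A} :
    (D.boundQuiver.tgt α = D.boundQuiver.src β ∧ ¬ D.boundQuiver.rel α β) ↔
      sideOf β = D.mate (next (sideOf α)) := by
  rw [tgt_eq, src_eq, arcOf_eq_iff, rel_iff]
  constructor
  · rintro ⟨h | h, h'⟩
    · exact absurd h h'
    · exact h
  · intro h
    exact ⟨Or.inr h, fun h' => isArc_next_sideOf α (h.symm.trans h')⟩

/-! ### Permitted and forbidden paths -/

/-- The `i`-th arrow of the path `l` is the angle at the initial vertex of `c` that precedes the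
`(i + 1)`-st rotation of `c`. -/
def PermFrom (l : List D.boundQuiver.A) (c : F × Fin (m + 2)) : Prop :=
  ∀ i (hi : i < l.length), sideOf l[i] = D.mate ((D.rot ^ i) c)

/-- The arrows of the path `l` are consecutive angles of a polygon, beginning at the side `d`. -/
def ForbFrom (l : List D.boundQuiver.A) (d : F × Fin (m + 2)) : Prop :=
  ∀ i (hi : i < l.length), sideOf l[i] = next^[i] d

theorem PermFrom.ext {l l' : List D.boundQuiver.A} {c : F × Fin (m + 2)} (h : PermFrom l c)
    (h' : PermFrom l' c) (hl : l.length = l'.length) : l = l' :=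
  List.ext_getElem hl fun i hi hi' => sideOf_injective ((h i hi).trans (h' i hi').symm)

theorem ForbFrom.ext {l l' : List D.boundQuiver.A} {d : F × Fin (m + 2)} (h : ForbFrom l d)
    (h' : ForbFrom l' d) (hl : l.length = l'.length) : l = l' :=
  List.ext_getElem hl fun i hi hi' => sideOf_injective ((h i hi).trans (h' i hi').symm)

theorem exists_permFrom {c : F × Fin (m + 2)} {n : ℕ} (h : ∀ i ≤ n, D.IsArc ((D.rot ^ i) c)) :
    ∃ l : List D.boundQuiver.A, l.length = n ∧ PermFrom l c :=
  ⟨List.ofFn fun i : Fin n => arrowOf (D.mate ((D.rot ^ (i : ℕ)) c)) (isArc_mate.2 (h i i.2.le))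
    (by
      have := h (i + 1) i.2
      rwa [pow_succ', Equiv.Perm.mul_apply] at this), by simp, fun i hi => by
    rw [List.getElem_ofFn]; rfl⟩

theorem exists_forbFrom {d : F × Fin (m + 2)} {n : ℕ} (h : ∀ i ≤ n, D.IsArc (next^[i] d)) :
    ∃ l : List D.boundQuiver.A, l.length = n ∧ ForbFrom l d :=
  ⟨List.ofFn fun i : Fin n => arrowOf (next^[i] d) (h i i.2.le)
    (by
      have := h (i + 1) i.2
      rwa [Function.iterate_succ_apply'] at this), by simp, fun i hi => by
    rw [List.getElem_ofFn]; rfl⟩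

theorem PermFrom.isArc {l : List D.boundQuiver.A} {c : F × Fin (m + 2)} (h : PermFrom l c)
    (hl : l ≠ []) {i : ℕ} (hi : i ≤ l.length) : D.IsArc ((D.rot ^ i) c) := by
  have hpos := List.length_pos_iff.2 hl
  rcases i with _ | i
  · have := isArc_sideOf l[0]
    rwa [h 0 hpos, isArc_mate] at this
  · have := isArc_next_sideOf l[i]
    rw [h i hi] at this
    rwa [pow_succ', Equiv.Perm.mul_apply]

theorem ForbFrom.isArc {l : List D.boundQuiver.A} {d : F × Fin (m + 2)} (h : ForbFrom l d)
    (hl : l ≠ []) {i : ℕ} (hi : i ≤ l.length) : D.IsArc (next^[i] d) := by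
  have hpos := List.length_pos_iff.2 hl
  rcases i with _ | i
  · have := isArc_sideOf l[0]
    rwa [h 0 hpos] at this
  · have := isArc_next_sideOf l[i]
    rwa [h i hi, ← Function.iterate_succ_apply' next] at this

theorem isPermitted_iff {l : List D.boundQuiver.A} :
    D.boundQuiver.IsPermitted l ↔ l ≠ [] ∧ ∃ c, PermFrom l c := by
  rw [BoundQuiver.isPermitted_iff]
  refine and_congr_right fun hl => ?_
  have hpos := List.length_pos_iff.2 hl
  simp_rw [comp_notMem_iff, List.isChain_iff_getElem]
  constructor
  · intro h
    refine ⟨D.mate (sideOf l[0]), fun i => ?_⟩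
    induction i with
    | zero => intro _; simp [D.mate_mate]
    | succ i ih =>
      intro hi
      rw [h i hi, ih (by omega), pow_succ', Equiv.Perm.mul_apply, rot_apply]
  · rintro ⟨c, h⟩ i hi
    rw [h (i + 1) hi, h i (by omega), pow_succ', Equiv.Perm.mul_apply, rot_apply]

theorem isChain_rel_iff {l : List D.boundQuiver.A} (hl : l ≠ []) :
    l.IsChain D.boundQuiver.rel ↔ ∃ d, ForbFrom l d := by
  have hpos := List.length_pos_iff.2 hl
  simp_rw [List.isChain_iff_getElem, rel_iff]
  constructor
  · intro h
    refine ⟨sideOf l[0], fun i => ?_⟩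
    induction i with
    | zero => intro _; rfl
    | succ i ih =>
      intro hi
      rw [h i hi, ih (by omega), Function.iterate_succ_apply']
  · rintro ⟨c, h⟩ i hi
    rw [h (i + 1) hi, h i (by omega), Function.iterate_succ_apply']

theorem isForbidden_iff {l : List D.boundQuiver.A} :
    D.boundQuiver.IsForbidden l ↔ l ≠ [] ∧ l.Nodup ∧ ∃ d, ForbFrom l d :=
  and_congr_right fun hl => and_congr_right fun _ => isChain_rel_iff hl

/-- A path with n arrows runs through the n + 1 arcs `c`, …, `rotⁿ c`. Prepending an arrow replaces
`c` by its predecessor and needs `prev c` to be an arc; appending one needs the next rotation to be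
an arc. -/
theorem isPermittedThread_iff {l : List D.boundQuiver.A} :
    D.boundQuiver.IsPermittedThread l ↔ l ≠ [] ∧ ∃ c, PermFrom l c ∧ ¬ D.IsArc (prev c) ∧
      ¬ D.IsArc ((D.rot ^ (l.length + 1)) c) := by
  simp_rw [BoundQuiver.IsPermittedThread, isPermitted_iff]
  constructor
  · rintro ⟨⟨hl, c, hc⟩, h⟩
    refine ⟨hl, c, hc, fun ha => ?_, fun ha => ?_⟩
    · refine (h (arrowOf (prev c) ha ?_)).1 ⟨by simp, D.rot.symm c, ?_⟩
      · rw [next_prev]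
        exact hc.isArc hl (Nat.zero_le _)
      · rintro (_ | i) hi
        · simp [rot_symm_apply, D.mate_mate]
        · simp only [List.getElem_cons_succ]
          rw [hc i (by simpa using hi), pow_succ, Equiv.Perm.mul_apply, Equiv.apply_symm_apply]
    · refine (h (arrowOf (D.mate ((D.rot ^ l.length) c)) ?_ ?_)).2 ⟨by simp, c, ?_⟩
      · exact isArc_mate.2 (hc.isArc hl le_rfl)
      · rwa [pow_succ', Equiv.Perm.mul_apply] at ha
      · intro i hi
        rw [List.getElem_append]
        split_ifs with hi'
        · exact hc i hi'
        · have : i = l.length := by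
            simp at hi
            omega
          subst this
          simp only [Nat.sub_self, List.getElem_singleton]
          rfl
  · rintro ⟨hl, c, hc, h1, h2⟩
    have hpos := List.length_pos_iff.2 hl
    refine ⟨⟨hl, c, hc⟩, fun β => ⟨?_, ?_⟩⟩
    · rintro ⟨hl', c', hc'⟩
      have e1 := hc' 1 (by simpa using hpos)
      have e0 := hc 0 hpos
      simp only [List.getElem_cons_succ] at e1
      rw [e0, pow_one, pow_zero, Equiv.Perm.one_apply] at e1
      have := hc'.isArc hl' (Nat.zero_le _)
      have e2 : c = D.rot c' := by rw [← D.mate_mate c, e1, D.mate_mate]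
      rw [e2, ← isArc_rot_symm, Equiv.symm_apply_apply] at h1
      exact h1 this
    · rintro ⟨hl', c', hc'⟩
      have e1 := hc' 0 (by simp)
      rw [List.getElem_append_left hpos, hc 0 hpos] at e1
      simp only [pow_zero, Equiv.Perm.one_apply] at e1
      have e2 : c' = c := by rw [← D.mate_mate c', ← e1, D.mate_mate]
      rw [e2] at hc'
      exact h2 (hc'.isArc hl' (by simp))

/-- In an internal polygon a full turn is also a forbidden thread, maximal only because arrows may
not repeat. The boundary side after `t` excludes this case. -/
theorem exists_forbFrom_of_isForbiddenThread {l : List D.boundQuiver.A}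
    (h : D.boundQuiver.IsForbiddenThread l) {t : F × Fin (m + 2)} (ht : ¬ D.IsArc (next t))
    (hlt : next (sideOf (l.getLast h.1.1)) = t) :
    ∃ d, ForbFrom l d ∧ ¬ D.IsArc (prev d) ∧ ¬ D.IsArc (next^[l.length + 1] d) := by
  obtain ⟨hl, hnd, d, hd⟩ := isForbidden_iff.1 h.1
  have hpos := List.length_pos_iff.2 hl
  have h2 : ¬ D.IsArc (next^[l.length + 1] d) := by
    rw [← hlt, List.getLast_eq_getElem, hd, ← Function.iterate_succ_apply' next,
      ← Function.iterate_succ_apply' next] at ht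
    rwa [Nat.succ_eq_add_one, Nat.sub_add_cancel hpos] at ht
  refine ⟨d, hd, fun ha => ?_, h2⟩
  refine (h.2 (arrowOf (prev d) ha ?_)).1 (isForbidden_iff.2 ⟨by simp, ?_, prev d, ?_⟩)
  · rw [next_prev]
    exact hd.isArc hl (Nat.zero_le _)
  -- If the arrow at `prev d` occurred already, the path would have closed up around the polygon,
  -- and the boundary side after its end would be one of its arcs.
  · refine List.nodup_cons.2 ⟨fun hm => ?_, hnd⟩
    obtain ⟨i, hi, he⟩ := List.getElem_of_mem hm
    have he := congrArg sideOf he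
    rw [hd i hi, sideOf_arrowOf] at he
    have he' : next^[i + 1] d = d := by rw [Function.iterate_succ_apply', he, next_prev]
    have : next^[l.length + 1] d = next^[l.length - i] d := by
      rw [show l.length + 1 = (l.length - i) + (i + 1) by omega, Function.iterate_add_apply, he']
    rw [this] at h2
    exact h2 (hd.isArc hl (by omega))
  · rintro (_ | i) hi
    · simp
    · simp only [List.getElem_cons_succ]
      rw [hd i (by simpa using hi), Function.iterate_succ_apply, next_prev]

/-- A repetition would bring `d` back, and then `prev d` would be one of the arcs. -/
theorem injOn_next_iterate {d : F × Fin (m + 2)} {n : ℕ} (h : ∀ i ≤ n, D.IsArc (next^[i] d))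
    (h1 : ¬ D.IsArc (prev d)) : ∀ i j, i < j → j ≤ n + 1 → next^[i] d ≠ next^[j] d := by
  intro i j hij hj he
  have : next^[j] d = next^[i] (next^[j - i] d) := by
    rw [← Function.iterate_add_apply, Nat.add_sub_cancel' hij.le]
  rw [this] at he
  have he := next_injective.iterate i he
  obtain ⟨k, hk⟩ : ∃ k, j - i = k + 1 := ⟨j - i - 1, by omega⟩
  rw [hk, Function.iterate_succ_apply'] at he
  have := congrArg prev he
  rw [prev_next] at this
  rw [this] at h1
  exact h1 (h k (by omega))

theorem ForbFrom.isForbiddenThread {l : List D.boundQuiver.A} {d : F × Fin (m + 2)}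
    (hl : l ≠ []) (hd : ForbFrom l d) (h1 : ¬ D.IsArc (prev d))
    (h2 : ¬ D.IsArc (next^[l.length + 1] d)) : D.boundQuiver.IsForbiddenThread l := by
  have hpos := List.length_pos_iff.2 hl
  refine ⟨isForbidden_iff.2 ⟨hl, ?_, d, hd⟩, fun β => ⟨?_, ?_⟩⟩
  · have key := injOn_next_iterate (n := l.length) (fun i hi => hd.isArc hl hi) h1
    rw [List.nodup_iff_injective_getElem]
    intro i j he
    have he := congrArg sideOf he
    rw [hd, hd] at he
    rcases lt_trichotomy i j with h | h | h
    · exact absurd he (key i j h (by omega))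
    · exact h
    · exact absurd he.symm (key j i h (by omega))
  · intro h
    obtain ⟨hl', -, d', hd'⟩ := isForbidden_iff.1 h
    have e1 := hd' 1 (by simpa using hpos)
    have e0 := hd 0 hpos
    simp only [List.getElem_cons_succ] at e1
    rw [e0] at e1
    have := hd'.isArc hl' (Nat.zero_le _)
    have e2 : d = next d' := e1
    rw [e2, prev_next] at h1
    exact h1 this
  · intro h
    obtain ⟨hl', -, d', hd'⟩ := isForbidden_iff.1 h
    have e1 := hd' 0 (by simp)
    rw [List.getElem_append_left hpos, hd 0 hpos] at e1
    have e2 : d = d' := e1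
    rw [← e2] at hd'
    exact h2 (hd'.isArc hl' (by simp))

theorem next_iterate_ne {d : F × Fin (m + 2)} {k : ℕ} (h0 : 0 < k) (hk : k < m + 2) :
    next^[k] d ≠ d := by
  intro h
  have h := congrArg (fun s => ((s.2 : Fin (m + 2)) : ℕ)) h
  simp only [next_iterate_snd] at h
  have := d.2.2
  rcases lt_or_ge ((d.2 : ℕ) + k) (m + 2) with h1 | h1
  · rw [Nat.mod_eq_of_lt h1] at h
    omega
  · rw [Nat.mod_eq_sub_mod h1, Nat.mod_eq_of_lt (by omega)] at h
    omega

/-- The arcs of the polygon form a single block: an arc after the boundary side that ends the block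
would produce a second start. -/
theorem numAngles_eq (hS : D.AtMostOneStart) {d : F × Fin (m + 2)} {n : ℕ}
    (h : ∀ i ≤ n, D.IsArc (next^[i] d)) (h1 : ¬ D.IsArc (prev d))
    (h2 : ¬ D.IsArc (next^[n + 1] d)) : D.numAngles d.1 = n := by
  have hd : d ∈ D.starts := ⟨h 0 (Nat.zero_le _), h1⟩
  have key := injOn_next_iterate h h1
  have hn : ∀ k, n + 1 ≤ k → k < m + 2 → ¬ D.IsArc (next^[k] d) := by
    intro k hk
    induction k, hk using Nat.le_induction with
    | base => exact fun _ => h2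
    | succ k hk ih =>
      intro hk' ha
      refine next_iterate_ne (by omega) hk' (hS _ ⟨ha, ?_⟩ d hd (next_iterate_fst _ _))
      rw [Function.iterate_succ_apply', prev_next]
      exact ih (by omega)
  have : {s | s.1 = d.1 ∧ D.IsArc s ∧ D.IsArc (next s)} =
      (fun i => next^[i] d) '' (Finset.range n : Set ℕ) := by
    ext s
    constructor
    · rintro ⟨a, b, c⟩
      obtain ⟨k, hk, rfl⟩ := exists_next_iterate_eq a.symm
      refine ⟨k, ?_, rfl⟩
      rw [← Function.iterate_succ_apply' next] at c
      -- The value `k = m + 1` would be the side `prev d`, which lies on the boundary.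
      have hk' : k + 1 < m + 2 := by
        by_contra hc
        have hp := next_iterate_period d
        obtain rfl : k = m + 1 := by omega
        rw [Function.iterate_succ_apply'] at hp
        rw [← hp, prev_next] at h1
        exact h1 b
      by_contra hc
      simp at hc
      exact hn (k + 1) (by omega) hk' c
    · rintro ⟨i, hi, rfl⟩
      simp at hi
      refine ⟨next_iterate_fst _ _, h i (by omega), ?_⟩
      change D.IsArc (next (next^[i] d))
      rw [← Function.iterate_succ_apply' next]
      exact h (i + 1) (by omega)
  rw [numAngles, this, Set.InjOn.ncard_image, Set.ncard_coe_finset, Finset.card_range]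
  intro i hi j hj he
  simp at hi hj
  rcases lt_trichotomy i j with h | h | h
  · exact absurd he (key i j h (by omega))
  · exact h
  · exact absurd he.symm (key j i h (by omega))

/-! ### Gentleness -/

/-- An arc has only two sides, which bounds the arrows at a vertex, and the two kinds of
continuation of an arrow are prescribed by `next` and its mate. A permitted path follows a run of
glued sides in an orbit of `rot`; without punctures such runs have bounded length. -/
theorem isGentle [Finite F] (hP : D.NoPuncture) : D.boundQuiver.IsGentle where
  finite_vertices := by
    refine Set.Finite.subset (Set.finite_range D.side) ?_
    rintro _ ⟨s, -, rfl⟩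
    exact ⟨s, rfl⟩
  finite_arrows := Finite.of_injective _ (sideOf_injective (D := D))
  starts_le_two x := by
    obtain ⟨s, hs, rfl⟩ := exists_eq_arcOf x
    rw [← Set.InjOn.ncard_image (f := sideOf) sideOf_injective.injOn]
    refine (Set.ncard_le_ncard (t := {s, D.mate s}) ?_ (Set.toFinite _)).trans
      ((Set.ncard_insert_le _ _).trans (by simp))
    rintro _ ⟨α, hα, rfl⟩
    exact (arcOf_eq_iff (h' := isArc_sideOf α)).1 (Eq.symm hα)
  stops_le_two x := by
    obtain ⟨s, hs, rfl⟩ := exists_eq_arcOf x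
    rw [← Set.InjOn.ncard_image (f := fun α => next (sideOf α))
      (next_injective.comp sideOf_injective).injOn]
    refine (Set.ncard_le_ncard (t := {s, D.mate s}) ?_ (Set.toFinite _)).trans
      ((Set.ncard_insert_le _ _).trans (by simp))
    rintro _ ⟨α, hα, rfl⟩
    exact (arcOf_eq_iff (h' := isArc_next_sideOf α)).1 (Eq.symm hα)
  rel_left_unique α α' β h h' :=
    sideOf_injective (next_injective ((rel_iff.1 h).symm.trans (rel_iff.1 h')))
  rel_right_unique β γ γ' h h' := sideOf_injective ((rel_iff.1 h).trans (rel_iff.1 h').symm)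
  nonrel_left_unique α α' β h1 h2 h1' h2' := by
    have h := comp_notMem_iff.1 ⟨h1, h2⟩
    rw [comp_notMem_iff.1 ⟨h1', h2'⟩] at h
    have h := congrArg D.mate h
    rw [D.mate_mate, D.mate_mate] at h
    exact (sideOf_injective (next_injective h)).symm
  nonrel_right_unique β γ γ' h1 h2 h1' h2' :=
    sideOf_injective ((comp_notMem_iff.1 ⟨h1, h2⟩).trans (comp_notMem_iff.1 ⟨h1', h2'⟩).symm)
  finite_permitted := by
    choose N hN using hP
    obtain ⟨K, hK⟩ := (Set.finite_range N).bddAbove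
    have : Finite D.boundQuiver.A := Finite.of_injective _ (sideOf_injective (D := D))
    refine (List.finite_length_le D.boundQuiver.A K).subset fun l hl => ?_
    obtain ⟨hl, c, hc⟩ := isPermitted_iff.1 hl
    by_contra hlt
    have h1 : ¬ l.length ≤ K := hlt
    have h2 : N c ≤ K := hK ⟨c, rfl⟩
    exact hN c (hc.isArc hl (by omega))

end PolygonSubdivision

namespace PolygonSubdivision

variable {m : ℕ} {P : Type u} [TopologicalSpace P] {F : Type v} {D : PolygonSubdivision m P F}

/-! ### Sign functions -/

variable (D) in
/-- A sign for every glued side, such that mates have opposite signs. -/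
def IsOrientation (e : F × Fin (m + 2) → ℤˣ) : Prop := ∀ s, D.IsArc s → e (D.mate s) = -e s

variable (D) in
theorem exists_isOrientation [Finite F] : ∃ e, D.IsOrientation e := by
  classical
  obtain ⟨n, ⟨g⟩⟩ := Finite.exists_equiv_fin (F × Fin (m + 2))
  refine ⟨fun s => if g s < g (D.mate s) then 1 else -1, fun s hs => ?_⟩
  have : g (D.mate s) ≠ g s := fun h => hs (g.injective h)
  simp only [D.mate_mate]
  rcases lt_or_gt_of_ne this with h | h
  · rw [if_pos h, if_neg h.asymm, neg_neg]
  · rw [if_neg h.asymm, if_pos h]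

/-- The sign functions defined by an orientation of the arcs. -/
def IsOrientation.signs {e : F × Fin (m + 2) → ℤˣ} (he : D.IsOrientation e) :
    D.boundQuiver.Signs where
  σ α := e (sideOf α)
  ε α := e (next (sideOf α))
  src_eq α β h h' := by
    rcases arcOf_eq_iff.1 ((src_eq α).symm.trans (h'.trans (src_eq β))) with h1 | h1
    · exact absurd (sideOf_injective h1).symm h
    · rw [h1, he _ (isArc_sideOf α), neg_neg]
  tgt_eq α β h h' := by
    rcases arcOf_eq_iff.1 ((tgt_eq α).symm.trans (h'.trans (tgt_eq β))) with h1 | h1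
    · exact absurd (sideOf_injective (next_injective h1)).symm h
    · rw [h1, he _ (isArc_next_sideOf α), neg_neg]
  of_not_rel α β h h' := by rw [comp_notMem_iff.1 ⟨h, h'⟩, he _ (isArc_next_sideOf α)]
  of_rel α β h := by rw [rel_iff.1 h]

/-- The sign functions `S` are those defined by the orientation `e`. -/
structure IsOrientationOf (S : D.boundQuiver.Signs) (e : F × Fin (m + 2) → ℤˣ) : Prop where
  isOrientation : D.IsOrientation e
  σ_eq : ∀ α, S.σ α = e (sideOf α)
  ε_eq : ∀ α, S.ε α = e (next (sideOf α))

/-- The at most four arrows touching an arc prescribe signs on its two sides, and the conditions on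
`S` say that these agree on one side and are opposite on mates. An arc without arrows gets an
arbitrary sign. -/
theorem exists_isOrientationOf [Finite F] (S : D.boundQuiver.Signs) :
    ∃ e, IsOrientationOf S e := by
  classical
  obtain ⟨e₀, he₀⟩ := D.exists_isOrientation
  have key : ∀ s, D.IsArc s → ∃ z : ℤˣ,
      (∀ α : D.boundQuiver.A, sideOf α = s → S.σ α = z) ∧
      (∀ α : D.boundQuiver.A, next (sideOf α) = s → S.ε α = z) ∧
      (∀ α : D.boundQuiver.A, sideOf α = D.mate s → S.σ α = -z) ∧
      (∀ α : D.boundQuiver.A, next (sideOf α) = D.mate s → S.ε α = -z) := by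
    intro s hs
    have r1 : ∀ α β : D.boundQuiver.A, sideOf α = s → sideOf β = D.mate s → S.σ α = -S.σ β := by
      intro α β h h'
      refine S.src_eq α β ?_ ?_
      · rintro rfl
        exact hs (h'.symm.trans h)
      · rw [src_eq, src_eq, arcOf_eq_iff, h, h']
        exact Or.inr rfl
    have r2 : ∀ α β : D.boundQuiver.A, next (sideOf α) = s → next (sideOf β) = D.mate s →
        S.ε α = -S.ε β := by
      intro α β h h'
      refine S.tgt_eq α β ?_ ?_
      · rintro rfl
        exact hs (h'.symm.trans h)
      · rw [tgt_eq, tgt_eq, arcOf_eq_iff, h, h']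
        exact Or.inr rfl
    have r3 : ∀ α β : D.boundQuiver.A, next (sideOf α) = sideOf β → S.σ β = S.ε α :=
      fun α β h => S.of_rel α β h.symm
    have r4 : ∀ α β : D.boundQuiver.A, sideOf β = D.mate (next (sideOf α)) → S.σ β = -S.ε α := by
      intro α β h
      obtain ⟨h1, h2⟩ := comp_notMem_iff.2 h
      exact S.of_not_rel α β h1 h2
    by_cases c1 : ∃ α : D.boundQuiver.A, sideOf α = s
    · obtain ⟨α, rfl⟩ := c1
      refine ⟨S.σ α, fun β h => by rw [sideOf_injective h], fun β h => (r3 β α h).symm,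
        fun β h => ?_, fun β h => ?_⟩
      · rw [r1 α β rfl h, neg_neg]
      · rw [r4 β α (by rw [h, D.mate_mate]), neg_neg]
    by_cases c2 : ∃ α : D.boundQuiver.A, next (sideOf α) = s
    · obtain ⟨α, rfl⟩ := c2
      refine ⟨S.ε α, fun β h => absurd ⟨β, h⟩ c1,
        fun β h => by rw [sideOf_injective (next_injective h)], fun β h => r4 α β h, fun β h => ?_⟩
      rw [r2 α β rfl h, neg_neg]
    by_cases c3 : ∃ α : D.boundQuiver.A, sideOf α = D.mate s
    · obtain ⟨α, hα⟩ := c3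
      refine ⟨-S.σ α, fun β h => absurd ⟨β, h⟩ c1, fun β h => absurd ⟨β, h⟩ c2,
        fun β h => ?_, fun β h => ?_⟩
      · rw [sideOf_injective (h.trans hα.symm), neg_neg]
      · rw [neg_neg, r3 β α (h.trans hα.symm)]
    by_cases c4 : ∃ α : D.boundQuiver.A, next (sideOf α) = D.mate s
    · obtain ⟨α, hα⟩ := c4
      refine ⟨-S.ε α, fun β h => absurd ⟨β, h⟩ c1, fun β h => absurd ⟨β, h⟩ c2,
        fun β h => absurd ⟨β, h⟩ c3, fun β h => ?_⟩
      rw [sideOf_injective (next_injective (h.trans hα.symm)), neg_neg]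
    · exact ⟨1, fun β h => absurd ⟨β, h⟩ c1, fun β h => absurd ⟨β, h⟩ c2,
        fun β h => absurd ⟨β, h⟩ c3, fun β h => absurd ⟨β, h⟩ c4⟩
  choose! z hz1 hz2 hz3 hz4 using key
  -- The values `z s` and `z (mate s)` were chosen independently, so `e₀` selects the side of each
  -- arc whose value is used.
  refine ⟨fun s => if e₀ s = 1 then z s else -z (D.mate s), fun s hs => ?_, fun α => ?_,
    fun α => ?_⟩
  · simp only [D.mate_mate, he₀ s hs]
    rcases Int.units_eq_one_or (e₀ s) with h | h
    · rw [h, if_pos rfl, if_neg (by decide)]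
    · rw [h, neg_neg, if_pos rfl, if_neg (by decide), neg_neg]
  · have h := isArc_sideOf α
    split_ifs with h1
    · exact hz1 _ h α rfl
    · exact hz3 _ (isArc_mate.2 h) α (D.mate_mate _).symm
  · have h := isArc_next_sideOf α
    split_ifs with h1
    · exact hz2 _ h α rfl
    · exact hz4 _ (isArc_mate.2 h) α (D.mate_mate _).symm

/-- Hence an arc together with a sign is the same thing as a glued side, and matching end points and
signs of threads means matching sides. -/
theorem IsOrientation.eq_of_side_eq {e : F × Fin (m + 2) → ℤˣ} (he : D.IsOrientation e)
    {s t : F × Fin (m + 2)} (hs : D.IsArc s) (h : D.side s = D.side t) (h' : e s = e t) :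
    s = t := by
  rcases side_eq_iff.1 h with rfl | rfl
  · rfl
  · rw [he s hs] at h'
    exact absurd h' (units_ne_neg_self _)

theorem IsOrientation.exists_arcOf {e : F × Fin (m + 2) → ℤˣ} (he : D.IsOrientation e)
    (x : D.boundQuiver.V) (z : ℤˣ) : ∃ s h, x = arcOf (D := D) s h ∧ e s = z := by
  obtain ⟨s, h, rfl⟩ := exists_eq_arcOf x
  by_cases hz : e s = z
  · exact ⟨s, h, rfl, hz⟩
  · refine ⟨D.mate s, isArc_mate.2 h, (arcOf_mate h).symm, ?_⟩
    rw [he s h]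
    rcases Int.units_eq_one_or (e s) with h1 | h1 <;>
      rcases Int.units_eq_one_or z with h2 | h2 <;> simp_all

/-! ### Threads -/

section Threads

variable {S : D.boundQuiver.Signs} {e : F × Fin (m + 2) → ℤˣ}

/-- The permitted thread `H` is formed by the angles between the arcs at the initial vertex of `c`,
and `c, …, rotⁿ c` are these arcs. -/
structure IsFan (e : F × Fin (m + 2) → ℤˣ) (H : S.PThread) (c : F × Fin (m + 2)) (n : ℕ) :
    Prop where
  isArc : ∀ i ≤ n, D.IsArc ((D.rot ^ i) c)
  not_isArc_prev : ¬ D.IsArc (prev c)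
  not_isArc_succ : ¬ D.IsArc ((D.rot ^ (n + 1)) c)
  start_eq : H.start.1 = D.side c
  sgnσ_eq : H.sgnσ = -e c
  finish_eq : H.finish.1 = D.side ((D.rot ^ n) c)
  sgnε_eq : H.sgnε = e ((D.rot ^ n) c)

/-- The forbidden thread `T` is formed by the consecutive angles of a polygon between its sides
`d, …, nextⁿ d`, which are the arcs among the sides of this polygon that follow `d`. -/
structure IsCorridor (e : F × Fin (m + 2) → ℤˣ) (T : S.FThread) (d : F × Fin (m + 2)) (n : ℕ) :
    Prop where
  isArc : ∀ i ≤ n, D.IsArc (next^[i] d)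
  not_isArc_prev : ¬ D.IsArc (prev d)
  not_isArc_succ : ¬ D.IsArc (next^[n + 1] d)
  start_eq : T.start.1 = D.side d
  sgnσ_eq : T.sgnσ = e d
  finish_eq : T.finish.1 = D.side (next^[n] d)
  sgnε_eq : T.sgnε = e (next^[n] d)
  length_eq : T.length = n

theorem PermFrom.isFan (he : IsOrientationOf S e) {l : List D.boundQuiver.A}
    {c : F × Fin (m + 2)} (hc : PermFrom l c) (hl : D.boundQuiver.IsPermittedThread l)
    (h1 : ¬ D.IsArc (prev c)) (h2 : ¬ D.IsArc ((D.rot ^ (l.length + 1)) c)) :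
    IsFan e (.inl ⟨l, hl⟩ : S.PThread) c l.length := by
  have hne := hl.1.1.1
  have hpos := List.length_pos_iff.2 hne
  have hh : sideOf (l.head hne) = D.mate c := by
    rw [List.head_eq_getElem, hc 0 hpos]
    rfl
  have ht : next (sideOf (l.getLast hne)) = (D.rot ^ l.length) c := by
    rw [List.getLast_eq_getElem, hc _ (by omega), ← rot_apply, ← Equiv.Perm.mul_apply, ← pow_succ',
      Nat.sub_add_cancel hpos]
  refine ⟨fun i hi => hc.isArc hne hi, h1, h2, ?_, ?_, ?_, ?_⟩
  · change D.side (sideOf (l.head hne)) = _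
    rw [hh, side_mate]
  · change S.σ (l.head hne) = _
    rw [he.σ_eq, hh, he.isOrientation c (hc.isArc hne (Nat.zero_le _))]
  · change D.side (next (sideOf (l.getLast hne))) = _
    rw [ht]
  · change S.ε (l.getLast hne) = _
    rw [he.ε_eq, ht]

/-- The sign of the thread selects the side `c`: an arrow ending on `c` or starting on its mate
would have the wrong sign. For an arc without arrows the two copies of the thread belong to its two
sides. -/
theorem isFan_trivial (he : IsOrientationOf S e) {c : F × Fin (m + 2)} (hc : D.IsArc c)
    (h) : IsFan e (.inr ⟨(arcOf c hc, -e c), h⟩ : S.PThread) c 0 := by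
  obtain ⟨-, hσ, hε⟩ := h
  refine ⟨fun i hi => ?_, fun ha => ?_, fun ha => ?_, rfl, rfl, rfl, neg_neg _⟩
  · rw [Nat.le_zero.1 hi]
    exact hc
  · have := hε (arrowOf (prev c) ha (by rwa [next_prev])) (by
      rw [tgt_eq, arcOf_eq_iff, sideOf_arrowOf, next_prev]; exact Or.inl rfl)
    rw [he.ε_eq, sideOf_arrowOf, next_prev] at this
    simp only [neg_neg] at this
    exact units_ne_neg_self _ this
  · have ha : D.IsArc (next (D.mate c)) := ha
    have := hσ (arrowOf (D.mate c) (isArc_mate.2 hc) ha) (by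
      rw [src_eq, arcOf_eq_iff, sideOf_arrowOf, D.mate_mate]; exact Or.inr rfl)
    rw [he.σ_eq, sideOf_arrowOf, he.isOrientation _ hc] at this
    simp only [neg_neg] at this
    exact units_ne_neg_self _ this.symm

theorem exists_isFan (he : IsOrientationOf S e) (H : S.PThread) : ∃ c n, IsFan e H c n := by
  rcases H with ⟨l, hl⟩ | ⟨⟨x, z⟩, h⟩
  · obtain ⟨-, c, hc, h1, h2⟩ := isPermittedThread_iff.1 hl
    exact ⟨c, _, hc.isFan he hl h1 h2⟩
  · obtain ⟨c, hc, rfl, hz⟩ := he.isOrientation.exists_arcOf x (-z)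
    obtain rfl : z = -e c := by rw [hz, neg_neg]
    exact ⟨c, 0, isFan_trivial he hc h⟩

theorem exists_pThread [Finite F] (hP : D.NoPuncture) (he : IsOrientationOf S e)
    {c : F × Fin (m + 2)} (hc : c ∈ D.starts) : ∃ (H : S.PThread) (n : ℕ), IsFan e H c n := by
  classical
  have hex := hP c
  have hpos : Nat.find hex ≠ 0 := fun h => by
    have := Nat.find_spec hex
    rw [h] at this
    exact this hc.1
  obtain ⟨n, hn⟩ := Nat.exists_eq_succ_of_ne_zero hpos
  have h2 := Nat.find_spec hex
  rw [hn] at h2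
  have hA : ∀ i ≤ n, D.IsArc ((D.rot ^ i) c) := fun i hi =>
    not_not.1 (Nat.find_min hex (m := i) (by omega))
  rcases Nat.eq_zero_or_pos n with rfl | hn0
  · have h2' : ¬ D.IsArc (next (D.mate c)) := h2
    refine ⟨.inr ⟨(arcOf c hc.1, -e c), ?_⟩, 0, isFan_trivial he hc.1 _⟩
    -- The boundary sides next to the arc leave room only for an arrow starting on `c` and one
    -- ending on `mate c`; their product is not a relation.
    have hsrc : ∀ α : D.boundQuiver.A, D.boundQuiver.src α = arcOf c hc.1 → sideOf α = c := by
      intro α hα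
      rw [src_eq, eq_comm, arcOf_eq_iff] at hα
      refine hα.resolve_right fun h => h2' ?_
      rw [← h]
      exact isArc_next_sideOf α
    have htgt : ∀ α : D.boundQuiver.A, D.boundQuiver.tgt α = arcOf c hc.1 →
        next (sideOf α) = D.mate c := by
      intro α hα
      rw [tgt_eq, eq_comm, arcOf_eq_iff] at hα
      refine hα.resolve_left fun h => hc.2 ?_
      rw [← h, prev_next]
      exact isArc_sideOf α
    refine ⟨⟨⟨fun α β h h' => ?_, fun α β h h' => ?_⟩, fun β γ h h' hr => ?_⟩, fun α h => ?_,
      fun β h => ?_⟩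
    · exact sideOf_injective ((hsrc α h).trans (hsrc β h').symm)
    · exact sideOf_injective (next_injective ((htgt α h).trans (htgt β h').symm))
    · rw [rel_iff, hsrc γ h', htgt β h] at hr
      exact hc.1 hr.symm
    · rw [he.σ_eq, hsrc α h]
    · rw [he.ε_eq, htgt β h, he.isOrientation _ hc.1]
  · obtain ⟨l, rfl, hl⟩ := exists_permFrom hA
    have hne := List.length_pos_iff.1 hn0
    exact ⟨.inl ⟨l, isPermittedThread_iff.2 ⟨hne, c, hl, hc.2, h2⟩⟩, l.length,
      hl.isFan he _ hc.2 h2⟩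

theorem IsFan.mem_starts {H : S.PThread} {c : F × Fin (m + 2)} {n : ℕ} (h : IsFan e H c n) :
    c ∈ D.starts := ⟨h.isArc 0 (Nat.zero_le _), h.not_isArc_prev⟩

theorem IsFan.length_unique {H H' : S.PThread} {c : F × Fin (m + 2)} {n n' : ℕ}
    (h : IsFan e H c n) (h' : IsFan e H' c n') : n = n' := by
  rcases lt_trichotomy n n' with hn | hn | hn
  · exact absurd (h'.isArc (n + 1) hn) h.not_isArc_succ
  · exact hn
  · exact absurd (h.isArc (n' + 1) hn) h'.not_isArc_succ

theorem IsFan.base_unique (he : IsOrientationOf S e) {H : S.PThread} {c c' : F × Fin (m + 2)}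
    {n n' : ℕ} (h : IsFan e H c n) (h' : IsFan e H c' n') : c = c' := by
  refine he.isOrientation.eq_of_side_eq (h.isArc 0 (Nat.zero_le _))
    (h.start_eq.symm.trans h'.start_eq) ?_
  exact neg_injective (h.sgnσ_eq.symm.trans h'.sgnσ_eq)

theorem IsFan.unique (he : IsOrientationOf S e) {H H' : S.PThread} {c : F × Fin (m + 2)}
    {n n' : ℕ} (h : IsFan e H c n) (h' : IsFan e H' c n') : H = H' := by
  have aux : ∀ {l : List D.boundQuiver.A} {hl : D.boundQuiver.IsPermittedThread l} {n : ℕ},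
      IsFan e (.inl ⟨l, hl⟩ : S.PThread) c n → PermFrom l c ∧ n = l.length := by
    intro l hl n h
    obtain ⟨-, c', hc, h1, h2⟩ := isPermittedThread_iff.1 hl
    have h' := hc.isFan he hl h1 h2
    obtain rfl := h.base_unique he h'
    exact ⟨hc, h.length_unique h'⟩
  have aux' : ∀ {x : D.boundQuiver.V} {z : ℤˣ} {hx} {n : ℕ},
      IsFan e (.inr ⟨(x, z), hx⟩ : S.PThread) c n →
      n = 0 ∧ x.1 = D.side c ∧ z = -e c := by
    intro x z hx n h
    refine ⟨?_, h.start_eq, h.sgnσ_eq⟩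
    obtain ⟨c', hc, rfl, hz⟩ := he.isOrientation.exists_arcOf x (-z)
    obtain rfl : z = -e c' := by rw [hz, neg_neg]
    have h' := isFan_trivial he hc hx
    obtain rfl := h.base_unique he h'
    exact h.length_unique h'
  have hn := h.length_unique h'
  subst hn
  rcases H with ⟨l, hl⟩ | ⟨⟨x, z⟩, hx⟩ <;> rcases H' with ⟨l', hl'⟩ | ⟨⟨x', z'⟩, hx'⟩
  · obtain ⟨a, b⟩ := aux h
    obtain ⟨a', b'⟩ := aux h'
    obtain rfl := a.ext a' (b.symm.trans b')
    rfl
  · have h1 := (aux h).2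
    rw [(aux' h').1] at h1
    exact absurd (List.length_eq_zero_iff.1 h1.symm) hl.1.1.1
  · have h1 := (aux h').2
    rw [(aux' h).1] at h1
    exact absurd (List.length_eq_zero_iff.1 h1.symm) hl'.1.1.1
  · obtain ⟨-, a, rfl⟩ := aux' h
    obtain ⟨-, a', rfl⟩ := aux' h'
    obtain rfl : x = x' := Subtype.ext (a.trans a'.symm)
    rfl

theorem ForbFrom.isCorridor (he : IsOrientationOf S e) {l : List D.boundQuiver.A}
    {d : F × Fin (m + 2)} (hd : ForbFrom l d) (hl : D.boundQuiver.IsForbiddenThread l)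
    (h1 : ¬ D.IsArc (prev d)) (h2 : ¬ D.IsArc (next^[l.length + 1] d)) :
    IsCorridor e (.inl ⟨l, hl⟩ : S.FThread) d l.length := by
  have hne := hl.1.1
  have hpos := List.length_pos_iff.2 hne
  have hh : sideOf (l.head hne) = d := by
    rw [List.head_eq_getElem, hd 0 hpos]
    rfl
  have ht : next (sideOf (l.getLast hne)) = next^[l.length] d := by
    rw [List.getLast_eq_getElem, hd _ (by omega), ← Function.iterate_succ_apply' next,
      Nat.succ_eq_add_one, Nat.sub_add_cancel hpos]
  refine ⟨fun i hi => hd.isArc hne hi, h1, h2, ?_, ?_, ?_, ?_, rfl⟩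
  · change D.side (sideOf (l.head hne)) = _
    rw [hh]
  · change S.σ (l.head hne) = _
    rw [he.σ_eq, hh]
  · change D.side (next (sideOf (l.getLast hne))) = _
    rw [ht]
  · change S.ε (l.getLast hne) = _
    rw [he.ε_eq, ht]

theorem isCorridor_trivial (he : IsOrientationOf S e) {d : F × Fin (m + 2)} (hd : D.IsArc d)
    (h) : IsCorridor e (.inr ⟨(arcOf d hd, e d), h⟩ : S.FThread) d 0 := by
  obtain ⟨-, hσ, hε⟩ := h
  refine ⟨fun i hi => ?_, fun ha => ?_, fun ha => ?_, rfl, rfl, rfl, rfl, rfl⟩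
  · rw [Nat.le_zero.1 hi]
    exact hd
  · have := hε (arrowOf (prev d) ha (by rwa [next_prev])) (by
      rw [tgt_eq, arcOf_eq_iff, sideOf_arrowOf, next_prev]; exact Or.inl rfl)
    rw [he.ε_eq, sideOf_arrowOf, next_prev] at this
    exact units_ne_neg_self _ this
  · have ha : D.IsArc (next d) := ha
    have := hσ (arrowOf d hd ha) (by
      rw [src_eq, arcOf_eq_iff, sideOf_arrowOf]; exact Or.inl rfl)
    rw [he.σ_eq, sideOf_arrowOf] at this
    exact units_ne_neg_self _ this

theorem exists_isCorridor (he : IsOrientationOf S e) {T : S.FThread} {t : F × Fin (m + 2)}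
    (ht' : ¬ D.IsArc (next t)) (h1 : T.finish.1 = D.side t)
    (h2 : T.sgnε = e t) : ∃ d n, IsCorridor e T d n := by
  rcases T with ⟨l, hl⟩ | ⟨⟨x, z⟩, h⟩
  · have hlt : next (sideOf (l.getLast hl.1.1)) = t := by
      refine he.isOrientation.eq_of_side_eq (isArc_next_sideOf _) h1 ?_
      rw [← he.ε_eq]
      exact h2
    obtain ⟨d, hd, a, b⟩ := exists_forbFrom_of_isForbiddenThread hl ht' hlt
    exact ⟨d, _, hd.isCorridor he hl a b⟩
  · obtain ⟨d, hd, rfl, rfl⟩ := he.isOrientation.exists_arcOf x z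
    exact ⟨d, 0, isCorridor_trivial he hd h⟩

theorem exists_fThread (he : IsOrientationOf S e) {d : F × Fin (m + 2)} {n : ℕ}
    (hA : ∀ i ≤ n, D.IsArc (next^[i] d)) (h1 : ¬ D.IsArc (prev d))
    (h2 : ¬ D.IsArc (next^[n + 1] d)) : ∃ T : S.FThread, IsCorridor e T d n := by
  have hd : D.IsArc d := hA 0 (Nat.zero_le _)
  rcases Nat.eq_zero_or_pos n with rfl | hn0
  · have h2' : ¬ D.IsArc (next d) := h2
    refine ⟨.inr ⟨(arcOf d hd, e d), ?_⟩, isCorridor_trivial he hd _⟩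
    -- Here the possible arrows start and end on the same side `mate d`, so their product is a
    -- relation.
    have hsrc : ∀ α : D.boundQuiver.A, D.boundQuiver.src α = arcOf d hd →
        sideOf α = D.mate d := by
      intro α hα
      rw [src_eq, eq_comm, arcOf_eq_iff] at hα
      refine hα.resolve_left fun h => h2' ?_
      rw [← h]
      exact isArc_next_sideOf α
    have htgt : ∀ α : D.boundQuiver.A, D.boundQuiver.tgt α = arcOf d hd →
        next (sideOf α) = D.mate d := by
      intro α hα
      rw [tgt_eq, eq_comm, arcOf_eq_iff] at hα
      refine hα.resolve_left fun h => h1 ?_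
      rw [← h, prev_next]
      exact isArc_sideOf α
    refine ⟨⟨⟨fun α β h h' => ?_, fun α β h h' => ?_⟩, fun β γ h h' => ?_⟩, fun α h => ?_,
      fun β h => ?_⟩
    · exact sideOf_injective ((hsrc α h).trans (hsrc β h').symm)
    · exact sideOf_injective (next_injective ((htgt α h).trans (htgt β h').symm))
    · rw [rel_iff, hsrc γ h', htgt β h]
    · rw [he.σ_eq, hsrc α h, he.isOrientation _ hd, neg_neg]
    · rw [he.ε_eq, htgt β h, he.isOrientation _ hd, neg_neg]
  · obtain ⟨l, rfl, hl⟩ := exists_forbFrom hA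
    have hne := List.length_pos_iff.1 hn0
    exact ⟨.inl ⟨l, hl.isForbiddenThread hne h1 h2⟩, hl.isCorridor he _ h1 h2⟩

end Threads

end PolygonSubdivision

/-- Both images are the quotient of `s` by the same equivalence relation. -/
theorem Set.ncard_image_eq_of_forall {α β γ : Type*} {s : Set α} {f : α → β} {g : α → γ}
    (h : ∀ a ∈ s, ∀ b ∈ s, f a = f b ↔ g a = g b) : (f '' s).ncard = (g '' s).ncard := by
  refine Set.ncard_congr (fun b hb => g hb.choose) (fun b hb => ⟨_, hb.choose_spec.1, rfl⟩) ?_ ?_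
  · intro b b' hb hb' he
    rw [← h _ hb.choose_spec.1 _ hb'.choose_spec.1, hb.choose_spec.2, hb'.choose_spec.2] at he
    exact he
  · rintro _ ⟨a, ha, rfl⟩
    have hb : f a ∈ f '' s := ⟨a, ha, rfl⟩
    exact ⟨f a, hb, (h _ hb.choose_spec.1 _ ha).1 hb.choose_spec.2⟩

namespace PolygonSubdivision

variable {m : ℕ} {P : Type u} [TopologicalSpace P] {F : Type v} {D : PolygonSubdivision m P F}

/-! ### First returns of the rotation -/

variable (D) in
/-- `d` is the first element of `D.starts` in the forward orbit of `c`, after `c` itself. -/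
def FirstReturn (c d : F × Fin (m + 2)) : Prop :=
  d ∈ D.starts ∧ ∃ j : ℕ, 0 < j ∧ (D.rot ^ j) c = d ∧
    ∀ i, 0 < i → i < j → (D.rot ^ i) c ∉ D.starts

theorem FirstReturn.right_unique {c d d' : F × Fin (m + 2)} (h : D.FirstReturn c d)
    (h' : D.FirstReturn c d') : d = d' := by
  obtain ⟨hd, j, hj, rfl, hj'⟩ := h
  obtain ⟨hd', k, hk, rfl, hk'⟩ := h'
  rcases lt_trichotomy j k with hlt | rfl | hlt
  · exact absurd hd (hk' j hj hlt)
  · rfl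
  · exact absurd hd' (hj' k hk hlt)

/-- If one return time were shorter, the orbit with the longer one would meet `starts` earlier, at
the difference of the two times. -/
theorem FirstReturn.left_unique {c c' d : F × Fin (m + 2)} (hc : c ∈ D.starts)
    (hc' : c' ∈ D.starts) (h : D.FirstReturn c d) (h' : D.FirstReturn c' d) : c = c' := by
  have aux : ∀ {c c' : F × Fin (m + 2)} {j k : ℕ}, c ∈ D.starts →
      (D.rot ^ j) c = (D.rot ^ k) c' → 0 < j →
      (∀ i, 0 < i → i < k → (D.rot ^ i) c' ∉ D.starts) → ¬ j < k := by
    intro c c' j k hc he hj hk hlt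
    refine hk (k - j) (by omega) (by omega) ?_
    have : (D.rot ^ j) c = (D.rot ^ j) ((D.rot ^ (k - j)) c') := by
      rw [he, ← Equiv.Perm.mul_apply, ← pow_add, Nat.add_sub_cancel' hlt.le]
    rw [← (D.rot ^ j).injective this]
    exact hc
  obtain ⟨-, j, hj, hjd, hj'⟩ := h
  obtain ⟨-, k, hk, hkd, hk'⟩ := h'
  have h1 := aux hc (hjd.trans hkd.symm) hj hk'
  have h2 := aux hc' (hkd.trans hjd.symm) hk hj'
  obtain rfl : j = k := by omega
  exact (D.rot ^ j).injective (hjd.trans hkd.symm)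

theorem FirstReturn.sameCycle {c d : F × Fin (m + 2)} (h : D.FirstReturn c d) :
    D.rot.SameCycle c d := by
  obtain ⟨-, j, -, rfl, -⟩ := h
  exact ⟨j, rfl⟩

section Sequence

variable {c : ℕ → F × Fin (m + 2)}

theorem mem_starts_of_firstReturn (hc0 : c 0 ∈ D.starts)
    (hc : ∀ i, D.FirstReturn (c i) (c (i + 1))) (i : ℕ) : c i ∈ D.starts := by
  cases i with
  | zero => exact hc0
  | succ i => exact (hc i).1

/-- The first return is injective, so a coincidence can be pulled back to index 0. -/
theorem eq_zero_of_firstReturn (hc0 : c 0 ∈ D.starts)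
    (hc : ∀ i, D.FirstReturn (c i) (c (i + 1))) {i j : ℕ} (hij : i ≤ j) (h : c i = c j) : c 0 = c (j - i) := by
  induction i generalizing j with
  | zero => exact h
  | succ i ih =>
    obtain ⟨j, rfl⟩ : ∃ k, j = k + 1 := ⟨j - 1, by omega⟩
    have h1 := hc i
    rw [h] at h1
    rw [Nat.add_sub_add_right]
    exact ih (by omega) (h1.left_unique (mem_starts_of_firstReturn hc0 hc i)
      (mem_starts_of_firstReturn hc0 hc j) (hc j))

theorem exists_return_of_firstReturn [Finite F] (hc0 : c 0 ∈ D.starts)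
    (hc : ∀ i, D.FirstReturn (c i) (c (i + 1))) : ∃ n, 0 < n ∧ c n = c 0 := by
  obtain ⟨i, j, hij, h⟩ := Finite.exists_ne_map_eq_of_infinite c
  rcases lt_or_gt_of_ne hij with hlt | hlt
  · exact ⟨j - i, by omega, (eq_zero_of_firstReturn hc0 hc hlt.le h).symm⟩
  · exact ⟨i - j, by omega, (eq_zero_of_firstReturn hc0 hc hlt.le h.symm).symm⟩

theorem injOn_of_firstReturn (hc0 : c 0 ∈ D.starts)
    (hc : ∀ i, D.FirstReturn (c i) (c (i + 1))) {n : ℕ} (hne : ∀ i, 0 < i → i < n → c i ≠ c 0) :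
    Set.InjOn c {i | i < n} := by
  intro i hi j hj h
  have hi : i < n := hi
  have hj : j < n := hj
  rcases lt_trichotomy i j with hlt | rfl | hlt
  · exact absurd (eq_zero_of_firstReturn hc0 hc hlt.le h).symm (hne _ (by omega) (by omega))
  · rfl
  · exact absurd (eq_zero_of_firstReturn hc0 hc hlt.le h.symm).symm (hne _ (by omega) (by omega))

/-- Jumping from one return to the next skips no start, and forward powers reach the whole orbit. -/
theorem image_eq_orbitStarts_of_firstReturn [Finite F] (hc0 : c 0 ∈ D.starts)
    (hc : ∀ i, D.FirstReturn (c i) (c (i + 1))) {n : ℕ} (hn : 0 < n) (hcn : c n = c 0) :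
    c '' {i | i < n} = D.orbitStarts (c 0) := by
  ext d
  constructor
  · rintro ⟨i, -, rfl⟩
    refine ⟨mem_starts_of_firstReturn hc0 hc i, ?_⟩
    induction i with
    | zero => exact .refl _ _
    | succ i ih => exact ih.trans (hc i).sameCycle
  · rintro ⟨hd, hs⟩
    obtain ⟨N, rfl⟩ := hs.exists_nat_pow_eq
    have key : ∀ N i, (D.rot ^ N) (c i) ∈ D.starts → ∃ k, c k = (D.rot ^ N) (c i) := by
      intro N
      induction N using Nat.strong_induction_on with
      | _ N ih =>
        intro i h
        obtain ⟨-, j, hj, hj1, hj2⟩ := hc i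
        rcases Nat.eq_zero_or_pos N with rfl | hN
        · exact ⟨i, rfl⟩
        rcases lt_or_ge N j with hlt | hge
        · exact absurd h (hj2 N hN hlt)
        · have : (D.rot ^ N) (c i) = (D.rot ^ (N - j)) (c (i + 1)) := by
            rw [← hj1, ← Equiv.Perm.mul_apply, ← pow_add, Nat.sub_add_cancel hge]
          rw [this] at h ⊢
          exact ih (N - j) (by omega) (i + 1) h
    obtain ⟨k, hk⟩ := key N 0 hd
    have hper : Function.Periodic c n := by
      intro i
      induction i with
      | zero => rw [Nat.zero_add, hcn]
      | succ i ih =>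
        have h1 := hc (i + n)
        rw [ih] at h1
        rw [Nat.add_right_comm]
        exact h1.right_unique (hc i)
    exact ⟨k % n, Nat.mod_lt _ hn, (hper.map_mod_nat k).trans hk⟩

end Sequence

/-! ### Runs of the algorithm -/

section Runs

variable {S : D.boundQuiver.Signs} {e : F × Fin (m + 2) → ℤˣ}

/-- The forbidden thread runs backwards through the arcs of a polygon from the last arc to the
first, `rot` forwards through its boundary sides. Both arrive at the same arc since the polygon has
only one block of each kind. -/
theorem IsFan.firstReturn [Finite F] (hI : D.NoIsolated) (hS : D.AtMostOneStart)
    (he : IsOrientationOf S e) {H H' : S.PThread} {T : S.FThread} {c d : F × Fin (m + 2)} {n n' : ℕ}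
    (h : IsFan e H c n) (h' : IsFan e H' d n') (h1 : T.finish = H.finish) (h2 : H.sgnε = -T.sgnε)
    (h3 : H'.start = T.start) (h4 : T.sgnσ = -H'.sgnσ) :
    D.FirstReturn c d ∧ T.length = D.numAngles d.1 := by
  set t := D.mate ((D.rot ^ n) c) with ht
  have hA : D.IsArc ((D.rot ^ n) c) := h.isArc n le_rfl
  have htn : next t = (D.rot ^ (n + 1)) c := by rw [pow_succ', Equiv.Perm.mul_apply]; rfl
  have hb : ¬ D.IsArc (next t) := htn ▸ h.not_isArc_succ
  have hf : T.finish.1 = D.side t := by rw [h1, h.finish_eq, ht, side_mate]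
  have hε : T.sgnε = e t := by
    rw [ht, he.isOrientation _ hA, ← h.sgnε_eq, h2, neg_neg]
  obtain ⟨d', k, hT⟩ := exists_isCorridor he hb hf hε
  have hd' : d = d' := by
    refine he.isOrientation.eq_of_side_eq (h'.isArc 0 (Nat.zero_le _)) ?_ ?_
    · rw [← h'.start_eq, h3, hT.start_eq]
    · rw [← hT.sgnσ_eq, h4, h'.sgnσ_eq, neg_neg]
  subst hd'
  have hdt : next^[k] d = t := he.isOrientation.eq_of_side_eq (hT.isArc k le_rfl)
    (hT.finish_eq.symm.trans hf) (hT.sgnε_eq.symm.trans hε)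
  refine ⟨⟨h'.mem_starts, ?_⟩, ?_⟩
  · obtain ⟨d', hd', hl⟩ := exists_leads hI hb
    -- Nondegeneracy enters here: `d'` is reached along the boundary and `d` along the arcs, and
    -- both are starts in the polygon of `t`.
    have : d' = d := hS d' hd' d h'.mem_starts (by
      rw [hl.fst_eq, next_fst, ← hdt, next_iterate_fst])
    subst this
    obtain ⟨k', hk', hk''⟩ := hl
    rw [htn, ← Equiv.Perm.mul_apply, ← pow_add] at hk'
    refine ⟨k' + (n + 1), by omega, hk', fun i hi hi' hst => ?_⟩
    -- After time `n` the orbit meets only boundary sides until it reaches the start; up to time `n`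
    -- it turns around one vertex, where each side after `c` is preceded by an arc.
    rcases Nat.lt_or_ge n i with hni | hni
    · have := hk'' (i - (n + 1)) (by omega)
      rw [htn, ← Equiv.Perm.mul_apply, ← pow_add, Nat.sub_add_cancel hni] at this
      exact this hst.1
    · obtain ⟨i, rfl⟩ : ∃ l, i = l + 1 := ⟨i - 1, by omega⟩
      have h5 := hst.2
      rw [← isArc_rot_symm, pow_succ', Equiv.Perm.mul_apply, Equiv.symm_apply_apply] at h5
      exact h5 (h.isArc i (by omega))
  · rw [hT.length_eq, numAngles_eq hS hT.isArc hT.not_isArc_prev hT.not_isArc_succ]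

/-- Go back around the polygon from `t` to the first arc of its block. -/
theorem IsFan.exists_step [Finite F] (hP : D.NoPuncture) (he : IsOrientationOf S e)
    {H : S.PThread} {c : F × Fin (m + 2)} {n : ℕ} (h : IsFan e H c n) :
    ∃ (T : S.FThread) (H' : S.PThread), (T.finish = H.finish ∧ H.sgnε = -T.sgnε) ∧
      (H'.start = T.start ∧ T.sgnσ = -H'.sgnσ) := by
  classical
  set t := D.mate ((D.rot ^ n) c) with ht
  have hA : D.IsArc ((D.rot ^ n) c) := h.isArc n le_rfl
  have htn : next t = (D.rot ^ (n + 1)) c := by rw [pow_succ', Equiv.Perm.mul_apply]; rfl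
  have hb : ¬ D.IsArc (next t) := htn ▸ h.not_isArc_succ
  have hLI : Function.LeftInverse (prev (F := F) (m := m)) next := prev_next
  have hRI : Function.LeftInverse (next (F := F) (m := m)) prev := next_prev
  have hex : ∃ k, ¬ D.IsArc (prev^[k] t) := by
    obtain ⟨k, -, hk⟩ := exists_next_iterate_eq (s := next t) (t := t) rfl
    refine ⟨k, ?_⟩
    conv in prev^[k] t => rw [← hk, hLI.iterate k]
    exact hb
  have hpos : Nat.find hex ≠ 0 := fun h => by
    have := Nat.find_spec hex
    rw [h] at this
    exact this (isArc_mate.2 hA)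
  obtain ⟨k, hk⟩ := Nat.exists_eq_succ_of_ne_zero hpos
  have hmin : ∀ i ≤ k, D.IsArc (prev^[i] t) := fun i hi =>
    not_not.1 (Nat.find_min hex (m := i) (by omega))
  have hlast := Nat.find_spec hex
  rw [hk, Function.iterate_succ_apply'] at hlast
  have hit : ∀ i ≤ k, next^[i] (prev^[k] t) = prev^[k - i] t := by
    intro i hi
    conv_lhs => rw [← Nat.add_sub_cancel' hi, Function.iterate_add_apply, hRI.iterate i]
  have hkt : next^[k] (prev^[k] t) = t := hRI.iterate k t
  obtain ⟨T, hT⟩ := exists_fThread he (d := prev^[k] t) (n := k)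
    (fun i hi => by rw [hit i hi]; exact hmin _ (Nat.sub_le _ _)) hlast
    (by rw [Function.iterate_succ_apply', hkt]; exact hb)
  obtain ⟨H', n', hH'⟩ := exists_pThread hP he (c := prev^[k] t) ⟨hmin k le_rfl, hlast⟩
  refine ⟨T, H', ⟨Subtype.ext ?_, ?_⟩, ⟨Subtype.ext ?_, ?_⟩⟩
  · rw [hT.finish_eq, h.finish_eq, hkt, ht, side_mate]
  · rw [hT.sgnε_eq, h.sgnε_eq, hkt, ht, he.isOrientation _ hA, neg_neg]
  · rw [hH'.start_eq, hT.start_eq]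
  · rw [hT.sgnσ_eq, hH'.sgnσ_eq, neg_neg]

/-- The permitted threads at the vertices on the boundary component of `c`. -/
def fans (S : D.boundQuiver.Signs) (e : F × Fin (m + 2) → ℤˣ) (c : F × Fin (m + 2)) :
    Set S.PThread :=
  {H | ∃ d ∈ D.orbitStarts c, ∃ n, IsFan e H d n}

variable (D) in
/-- The total number of angles in the polygons that contain an element of `D.orbitStarts c`. -/
noncomputable def totalAngles (c : F × Fin (m + 2)) : ℕ :=
  ∑ᶠ d ∈ D.orbitStarts c, D.numAngles d.1

theorem IsFan.of_isRun [Finite F] (hI : D.NoIsolated) (hS : D.AtMostOneStart)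
    (he : IsOrientationOf S e) {x : ℕ} {H : ℕ → S.PThread} {T : ℕ → S.FThread}
    (hR : S.IsRun x H T) {c : F × Fin (m + 2)} {n : ℕ} (h0 : IsFan e (H 0) c n) :
    (D.orbitStarts c).ncard = x ∧ H '' {i | i < x} = fans S e c ∧
      ∑ i ∈ Finset.range x, (T i).length = D.totalAngles c := by
  obtain ⟨hx, hT, hH, hxH, hne⟩ := hR
  choose b k hb using fun i => exists_isFan he (H i)
  obtain rfl : b 0 = c := (hb 0).base_unique he h0
  have hstep := fun i => (hb i).firstReturn hI hS he (hb (i + 1)) (hT i).1 (hT i).2 (hH i).1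
    (hH i).2
  have hret := fun i => (hstep i).1
  have hbx : b x = b 0 := by
    have := hb x
    rw [hxH] at this
    exact this.base_unique he (hb 0)
  have hbne : ∀ i, 0 < i → i < x → b i ≠ b 0 := fun i hi hi' hbi => by
    have := hb i
    rw [hbi] at this
    exact hne i hi hi' (this.unique he (hb 0))
  have hs := (hb 0).mem_starts
  have hinj := injOn_of_firstReturn hs hret hbne
  have himg := image_eq_orbitStarts_of_firstReturn hs hret hx hbx
  have hrange : {i | i < x} = (Finset.range x : Set ℕ) := by ext; simp
  refine ⟨?_, ?_, ?_⟩
  · rw [← himg, hinj.ncard_image, hrange, Set.ncard_coe_finset, Finset.card_range]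
  · ext H'
    constructor
    · rintro ⟨i, hi, rfl⟩
      exact ⟨b i, himg ▸ ⟨i, hi, rfl⟩, k i, hb i⟩
    · rintro ⟨d, hd, n', hH'⟩
      rw [← himg] at hd
      obtain ⟨i, hi, rfl⟩ := hd
      exact ⟨i, hi, (hb i).unique he hH'⟩
  · rw [totalAngles, ← himg, finsum_mem_image hinj, hrange, finsum_mem_coe_finset,
      Finset.sum_congr rfl fun i _ => (hstep i).2]
    -- The `i`-th forbidden thread lies in the polygon of `b (i + 1)`; the shift of the index is
    -- harmless because `b x = b 0`.
    have h1 := Finset.sum_range_succ (fun i => D.numAngles (b i).1) x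
    rw [Finset.sum_range_succ' (fun i => D.numAngles (b i).1), hbx] at h1
    exact Nat.add_right_cancel h1

theorem exists_isRun [Finite F] (hP : D.NoPuncture) (hI : D.NoIsolated) (hS : D.AtMostOneStart)
    (he : IsOrientationOf S e) {c : F × Fin (m + 2)} (hc : c ∈ D.starts) :
    ∃ x H T n, S.IsRun x H T ∧ IsFan e (H 0) c n := by
  classical
  obtain ⟨H₀, n, hH₀⟩ := exists_pThread hP he hc
  have hex : ∀ H : S.PThread, ∃ (T : S.FThread) (H' : S.PThread),
      (T.finish = H.finish ∧ H.sgnε = -T.sgnε) ∧ (H'.start = T.start ∧ T.sgnσ = -H'.sgnσ) :=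
    fun H => by
      obtain ⟨c, n, h⟩ := exists_isFan he H
      exact h.exists_step hP he
  choose T G hTG using hex
  let H : ℕ → S.PThread := fun i => G^[i] H₀
  have hsucc : ∀ i, H (i + 1) = G (H i) := fun i => Function.iterate_succ_apply' _ _ _
  choose b k hb using fun i => exists_isFan he (H i)
  have hb0 : b 0 = c := (hb 0).base_unique he hH₀
  have hret : ∀ i, D.FirstReturn (b i) (b (i + 1)) := fun i => by
    have h1 := hb (i + 1)
    rw [hsucc] at h1
    exact ((hb i).firstReturn hI hS he h1 (hTG _).1.1 (hTG _).1.2 (hTG _).2.1 (hTG _).2.2).1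
  have hx := exists_return_of_firstReturn (hb 0).mem_starts hret
  have hspec := Nat.find_spec hx
  refine ⟨Nat.find hx, H, fun i => T (H i), n, ⟨hspec.1, fun i => (hTG _).1, fun i => ?_, ?_, ?_⟩,
    hH₀⟩
  · rw [hsucc]
    exact (hTG _).2
  · have := hb (Nat.find hx)
    rw [hspec.2] at this
    exact this.unique he (hb 0)
  · intro i hi hi' h
    have := hb i
    rw [h] at this
    exact Nat.find_min hx hi' ⟨hi, this.base_unique he (hb 0)⟩

theorem fans_eq_iff [Finite F] (hP : D.NoPuncture) (he : IsOrientationOf S e)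
    {c c' : F × Fin (m + 2)} (hc : c ∈ D.starts) :
    fans S e c = fans S e c' ↔ D.rot.SameCycle c c' := by
  constructor
  · intro h
    obtain ⟨H, n, hH⟩ := exists_pThread (S := S) hP he hc
    have : H ∈ fans S e c := ⟨c, ⟨hc, .refl _ _⟩, n, hH⟩
    rw [h] at this
    obtain ⟨d, hd, n', hH'⟩ := this
    rw [hH.base_unique he hH']
    exact hd.2.symm
  · intro h
    have : D.orbitStarts c = D.orbitStarts c' := by
      ext d
      exact ⟨fun hd => ⟨hd.1, h.symm.trans hd.2⟩, fun hd => ⟨hd.1, h.trans hd.2⟩⟩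
    rw [fans, fans, this]

theorem runs_eq [Finite F] (hP : D.NoPuncture) (hI : D.NoIsolated) (hS : D.AtMostOneStart)
    (he : IsOrientationOf S e) (x y : ℕ) :
    {O : Set S.PThread | ∃ H T, S.IsRun x H T ∧ O = H '' {i | i < x} ∧
      ∑ i ∈ Finset.range x, (T i).length = y} =
    fans S e '' {c | c ∈ D.starts ∧ (D.orbitStarts c).ncard = x ∧ D.totalAngles c = y} := by
  ext O
  constructor
  · rintro ⟨H, T, hR, rfl, rfl⟩
    obtain ⟨c, n, hc⟩ := exists_isFan he (H 0)
    obtain ⟨h1, h2, h3⟩ := hc.of_isRun hI hS he hR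
    exact ⟨c, ⟨hc.mem_starts, h1, h3.symm⟩, h2.symm⟩
  · rintro ⟨c, ⟨hc, rfl, rfl⟩, rfl⟩
    obtain ⟨x, H, T, n, hR, hn⟩ := exists_isRun hP hI hS he hc
    obtain ⟨h1, h2, h3⟩ := hn.of_isRun hI hS he hR
    rw [h1]
    exact ⟨H, T, hR, h2.symm, h3⟩

end Runs

/-! ### Cycles with full relations -/

/-- Relations keep turning around one polygon. Closing up takes at least m + 2 steps, and
distinctness of the arrows allows no more. -/
theorem chain_coe_cons_iff {a : D.boundQuiver.A} {l : List D.boundQuiver.A} (hn : (a :: l).Nodup) :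
    Cycle.Chain D.boundQuiver.rel ((a :: l : List D.boundQuiver.A) : Cycle D.boundQuiver.A) ↔
      ForbFrom (a :: l) (sideOf a) ∧ l.length + 1 = m + 2 := by
  rw [Cycle.chain_coe_cons, isChain_rel_iff (by simp)]
  constructor
  · rintro ⟨d, hd⟩
    have h0 : sideOf a = d := hd 0 (by simp)
    subst h0
    have hF : ForbFrom (a :: l) (sideOf a) := by
      intro i hi
      have hi' : i < (a :: (l ++ [a])).length := by
        simp only [List.length_cons, List.length_append] at hi ⊢
        omega
      rw [← hd i hi']
      congr 1
      exact (List.getElem_append_left (bs := [a]) hi).symm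
    refine ⟨hF, ?_⟩
    have hlast : next^[l.length + 1] (sideOf a) = sideOf a := by
      rw [← hd (l.length + 1) (by simp)]
      simp
    by_contra hlen
    rcases lt_or_gt_of_ne hlen with hlt | hgt
    · exact next_iterate_ne (Nat.succ_pos _) hlt hlast
    · have h1 := hF (m + 2) (by simpa using hgt)
      rw [next_iterate_period] at h1
      have h2 := sideOf_injective h1
      rw [List.nodup_iff_injective_getElem] at hn
      have := @hn ⟨m + 2, by simpa using hgt⟩ ⟨0, by simp⟩ h2
      simp at this
  · rintro ⟨hF, hlen⟩
    refine ⟨sideOf a, fun i hi => ?_⟩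
    by_cases hi' : i < (a :: l).length
    · rw [← hF i hi']
      congr 1
      exact List.getElem_append_left (bs := [a]) hi'
    · have : i = l.length + 1 := by
        simp at hi hi'
        omega
      subst this
      rw [show next^[l.length + 1] (sideOf a) = sideOf a by
        convert next_iterate_period (sideOf a)]
      simp

theorem mem_internal_iff {f : F} : f ∈ D.internal ↔ ∀ j, D.IsArc (f, j) :=
  forall_congr' fun _ => side_mem_arcs_iff

theorem ncard_cycles (y : ℕ) :
    {c : Cycle D.boundQuiver.A | c ≠ Cycle.nil ∧ c.Nodup ∧ c.Chain D.boundQuiver.rel ∧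
      c.length = y}.ncard = if y = m + 2 then D.internal.ncard else 0 := by
  -- Starting the cycle at the side with index `0` gives a canonical list for each internal polygon.
  have hrep : ∀ c : Cycle D.boundQuiver.A, c ≠ Cycle.nil → c.Nodup → c.Chain D.boundQuiver.rel →
      ∃ f ∈ D.internal, ∃ l : List D.boundQuiver.A, c = l ∧ l.length = m + 2 ∧
        ForbFrom l (f, 0) := by
    intro c
    induction c using Quotient.inductionOn with
    | _ l =>
    change ((l : Cycle D.boundQuiver.A) ≠ Cycle.nil → (l : Cycle D.boundQuiver.A).Nodup →
      (l : Cycle D.boundQuiver.A).Chain D.boundQuiver.rel → ∃ f ∈ D.internal,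
      ∃ l' : List D.boundQuiver.A, (l : Cycle D.boundQuiver.A) = l' ∧ _)
    intro h0 h1 h2
    obtain ⟨a, l, rfl⟩ := List.exists_cons_of_ne_nil (fun h => h0 (by rw [h]; rfl) : l ≠ [])
    rw [Cycle.nodup_coe_iff] at h1
    obtain ⟨hF, hlen⟩ := (chain_coe_cons_iff h1).1 h2
    set f := (sideOf a).1 with hf
    have hmem : ∀ s : F × Fin (m + 2), s.1 = f → ∃ b ∈ a :: l, sideOf b = s := by
      intro s hs
      obtain ⟨k, hk, rfl⟩ := exists_next_iterate_eq (s := sideOf a) (t := s) hs.symm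
      have hk' : k < (a :: l).length := by
        rw [List.length_cons, hlen]
        exact hk
      exact ⟨_, List.getElem_mem hk', hF k hk'⟩
    refine ⟨f, mem_internal_iff.2 fun j => ?_, ?_⟩
    · obtain ⟨b, -, hb⟩ := hmem (f, j) rfl
      exact hb ▸ isArc_sideOf b
    · obtain ⟨b, hb, hbs⟩ := hmem (f, 0) rfl
      obtain ⟨l₁, l₂, hl⟩ := List.append_of_mem hb
      have hrot : ((a :: l : List D.boundQuiver.A) : Cycle D.boundQuiver.A) =
          ((b :: (l₂ ++ l₁) : List D.boundQuiver.A) : Cycle D.boundQuiver.A) := by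
        rw [hl, Cycle.coe_eq_coe]
        exact List.isRotated_append
      have hn : (b :: (l₂ ++ l₁)).Nodup := by
        rw [← Cycle.nodup_coe_iff, ← hrot, Cycle.nodup_coe_iff]
        exact h1
      rw [hrot] at h2 ⊢
      obtain ⟨hF', hlen'⟩ := (chain_coe_cons_iff hn).1 h2
      exact ⟨_, rfl, hlen', hbs ▸ hF'⟩
  split_ifs with hy
  · subst hy
    have hex : ∀ f ∈ D.internal, ∃ l : List D.boundQuiver.A, l.length = m + 2 ∧
        ForbFrom l (f, 0) := by
      intro f hf
      rw [mem_internal_iff] at hf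
      refine exists_forbFrom fun i _ => ?_
      have := hf (next^[i] (f, 0)).2
      have h1 : (f, (next^[i] (f, (0 : Fin (m + 2)))).2) = next^[i] (f, 0) :=
        Prod.ext (next_iterate_fst (f, 0) i).symm rfl
      rwa [h1] at this
    choose! L hL1 hL2 using hex
    have hset : {c : Cycle D.boundQuiver.A | c ≠ Cycle.nil ∧ c.Nodup ∧
        c.Chain D.boundQuiver.rel ∧ c.length = m + 2} =
        (fun f => (L f : Cycle D.boundQuiver.A)) '' D.internal := by
      ext c
      constructor
      · rintro ⟨h0, h1, h2, -⟩
        obtain ⟨f, hf, l, rfl, hl, hl'⟩ := hrep c h0 h1 h2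
        exact ⟨f, hf, congrArg _ ((hL2 f hf).ext hl' ((hL1 f hf).trans hl.symm))⟩
      · rintro ⟨f, hf, rfl⟩
        have h1 := hL1 f hf
        have h2 := hL2 f hf
        change (L f : Cycle D.boundQuiver.A) ≠ Cycle.nil ∧ (L f : Cycle D.boundQuiver.A).Nodup ∧
          (L f : Cycle D.boundQuiver.A).Chain D.boundQuiver.rel ∧
          (L f : Cycle D.boundQuiver.A).length = m + 2
        generalize L f = l at h1 h2 ⊢
        rcases l with _ | ⟨a, l⟩
        · simp at h1
        have hn : (a :: l).Nodup := by
          rw [List.nodup_iff_injective_getElem]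
          have aux : ∀ i j : ℕ, i < j → j < m + 2 →
              next^[i] (f, (0 : Fin (m + 2))) ≠ next^[j] (f, 0) := by
            intro i j hij hj h
            rw [← Nat.add_sub_cancel' hij.le, Function.iterate_add_apply] at h
            exact next_iterate_ne (by omega) (by omega) (next_injective.iterate i h).symm
          intro i j hij
          have hij := congrArg sideOf hij
          rw [h2, h2] at hij
          have hi : (i : ℕ) < m + 2 := h1 ▸ i.2
          have hj : (j : ℕ) < m + 2 := h1 ▸ j.2
          rcases lt_trichotomy i j with h | h | h
          · exact absurd hij (aux i j h hj)
          · exact h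
          · exact absurd hij.symm (aux j i h hi)
        have ha : sideOf a = (f, 0) := h2 0 (by simp)
        refine ⟨by simp, Cycle.nodup_coe_iff.2 hn, (chain_coe_cons_iff hn).2 ⟨ha ▸ h2, h1⟩, h1⟩
    rw [hset, Set.InjOn.ncard_image]
    intro f hf f' hf' h
    have hpos : 0 < (L f).length := by rw [hL1 f hf]; omega
    have hm : (L f)[0] ∈ L f' := by
      have h' : (L f : Cycle D.boundQuiver.A) = L f' := h
      rw [← Cycle.mem_coe_iff, ← h']
      exact Cycle.mem_coe_iff.2 (List.getElem_mem hpos)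
    obtain ⟨i, hi, hi'⟩ := List.getElem_of_mem hm
    have h2 := congrArg (fun α => (sideOf α).1) hi'
    simp only [hL2 f hf 0 hpos, hL2 f' hf' i hi, next_iterate_fst] at h2
    exact h2.symm
  · refine (congrArg Set.ncard (Set.eq_empty_of_forall_notMem ?_)).trans (Set.ncard_empty _)
    rintro c ⟨h0, h1, h2, h3⟩
    obtain ⟨f, hf, l, rfl, hl, hl'⟩ := hrep c h0 h1 h2
    exact hy (h3.symm.trans hl)

/-! ### The main theorem -/

theorem finsum_pairStar {α : Type*} {s : Set α} (hs : s.Finite) (a b : α → ℤ) (x y : ℕ) :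
    (∑ᶠ C ∈ s, pairStar (a C) (b C)) x y = {C | C ∈ s ∧ a C = x ∧ b C = y}.ncard := by
  classical
  rw [finsum_mem_eq_finite_toFinset_sum _ hs, Finset.sum_apply, Finset.sum_apply]
  simp only [pairStar]
  rw [Finset.sum_boole, Nat.cast_id, ← Set.ncard_coe_finset]
  congr 1
  ext C
  simp [eq_comm]

end PolygonSubdivision

open PolygonSubdivision in
theorem mainTheorem3 {m : ℕ} (hm : 1 ≤ m) {P : Type u} [TopologicalSpace P] [T2Space P]
    {F : Type v} [Finite F] (D : Angulation m P F)
    (hT : ∀ p : P, ∃ τ ∈ D.arcs, (τ ∩ connectedComponent p).Nonempty)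
    (hD : D.Nondegenerate) :
    D.boundQuiver.IsGentle ∧ Nonempty D.boundQuiver.Signs ∧
    ∀ S : D.boundQuiver.Signs,
      S.agInvariant = D.internal.ncard • pairStar 0 (m + 2) +
        ∑ᶠ C ∈ D.boundaryComponents,
          pairStar ((D.markedT ∩ C).ncard : ℤ)
            (∑ᶠ b ∈ {b | b ∈ D.segments ∧ b ⊆ C}, ((m : ℤ) - (D.weight b : ℤ))) := by
  have hP : D.NoPuncture := noPuncture_of_marked_subset D.marked_subset_boundary
  have hI : D.NoIsolated := noIsolated_of_arcs hT
  have hS : D.AtMostOneStart := hD.atMostOneStart hP hI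
  obtain ⟨e₀, he₀⟩ := D.toPolygonSubdivision.exists_isOrientation
  refine ⟨isGentle hP, ⟨he₀.signs⟩, fun S => ?_⟩
  obtain ⟨e, he⟩ := exists_isOrientationOf S
  have hB := boundaryComponents_eq hI
  have hfin : D.boundaryComponents.Finite := hB ▸ (Set.toFinite _).image _
  funext x y
  rw [Pi.add_apply, Pi.add_apply, finsum_pairStar hfin, BoundQuiver.Signs.agInvariant,
    runs_eq hP hI hS he, ncard_cycles, add_comm]
  congr 1
  · simp only [Pi.smul_apply, pairStar, smul_eq_mul]
    by_cases hx : x = 0 <;> by_cases hy : y = m + 2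
    · simp [hx, hy]
    · have : ¬ (y : ℤ) = m + 2 := by omega
      simp [hx, hy, this]
    · simp [hx]
    · simp [hx]
  · have : {C | C ∈ D.boundaryComponents ∧ ((D.markedT ∩ C).ncard : ℤ) = x ∧
        ∑ᶠ b ∈ {b | b ∈ D.segments ∧ b ⊆ C}, ((m : ℤ) - (D.weight b : ℤ)) = y} =
        D.bdryCycle '' {c | c ∈ D.starts ∧ (D.orbitStarts c).ncard = x ∧ D.totalAngles c = y} := by
      rw [hB]
      ext C
      constructor
      · rintro ⟨⟨c, hc, rfl⟩, h1, h2⟩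
        rw [ncard_markedT_inter_bdryCycle hP, Nat.cast_inj] at h1
        rw [finsum_segments hP hI hS, Nat.cast_inj] at h2
        exact ⟨c, ⟨hc, h1, h2⟩, rfl⟩
      · rintro ⟨c, ⟨hc, h1, h2⟩, rfl⟩
        refine ⟨⟨c, hc, rfl⟩, ?_, ?_⟩
        · rw [ncard_markedT_inter_bdryCycle hP, h1]
        · rw [finsum_segments hP hI hS, ← h2]
          rfl
    rw [this]
    -- Runs and boundary components are both indexed by the orbits of `rot` on the same set of
    -- starts.
    refine Set.ncard_image_eq_of_forall fun c hc c' hc' => ?_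
    rw [fans_eq_iff hP he hc.1, bdryCycle_eq_iff hc'.1]
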